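/- Let $p$ be a prime and let $E/\mathbb{Q}$ be an elliptic curve given by a Weierstrass equation $y^2+a_1xy+a_3y=x^3+a_2x^2+a_4x+a_6$ over $\mathbb{Q}$ with coefficients integral at $p$, which is not minimal at $p$. Let $E_{\min}$ be a Weierstrass equation over $\mathbb{Q}$ which is minimal at $p$ and is obtained from $E$ by a change of coordinates $x=u^2x'+r$, $y=u^3y'+u^2sx'+t$ with $u\in\mathbb{Q}^\times$ and $r,s,t\in\mathbb{Q}$. Let $\Delta,\Delta_{\min}$ be the discriminants of $E$ and $E_{\min}$, let $v_p$ be the $p$-adic valuation, and let $$k=\frac{v_p(\Delta)-v_p(\Delta_{\min})}{12}.$$ For a $p$-integral Weierstrass equation $W$ let $W^0(\mathbb{Q}_p)\subseteq W(\mathbb{Q}_p)$ be the set of points whose reduction modulo $p$ (with respect to the equation $W$) is nonsingular, and for $n\ge 1$ let $W^n(\mathbb{Q}_p)$ be the $n$-th step of the formal group filtration, that is, the point at infinity $O$ together with the points $(x,y)$ which reduce to $O$ modulo $p$ and satisfy $-x/y\in p^n\mathbb{Z}_p$. Let $c_p=[E_{\min}(\mathbb{Q}_p):E_{\min}^0(\mathbb{Q}_p)]$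 be the Tamagawa number, and let $N_p$ be the number of nonsingular $\mathbb{F}_p$-points (including the point at infinity) of the reduction of $E_{\min}$ modulo $p$. Then $k$ is an integer with $k\ge 1$; the sets $E^n(\mathbb{Q}_p)$ and $E_{\min}^n(\mathbb{Q}_p)$, $n\ge 0$, are subgroups; the change of coordinates defines a group isomorphism $E(\mathbb{Q}_p)\to E_{\min}(\mathbb{Q}_p)$, $(x,y)\mapsto(x',y')$, which maps $E^n(\mathbb{Q}_p)$ isomorphically onto $E_{\min}^{n+k}(\mathbb{Q}_p)$ for every $n\ge 0$; the index $c_p$ is finite; and $$[E(\mathbb{Q}_p):E^0(\mathbb{Q}_p)]=[E_{\min}(\mathbb{Q}_p):E_{\min}^k(\mathbb{Q}_p)]=c_p\,N_p\,p^{k-1}.$$ -/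

import Mathlib

open scoped WeierstrassCurve

namespace PadicFiltration

variable (p : ℕ) [Fact p.Prime]

/-- The reduction modulo `p` of the Weierstrass equation `W` over `ℚ_p`, which has coefficients in
`ℤ_p` but is not assumed to be minimal. -/
noncomputable def reductionMod (W : WeierstrassCurve ℚ_[p])
    [WeierstrassCurve.IsIntegral ℤ_[p] W] : WeierstrassCurve (ZMod p) :=
  (WeierstrassCurve.integralModel ℤ_[p] W).map (PadicInt.toZMod (p := p))

/-- The number `N_p` of nonsingular `𝔽_p`-points of the reduction of `W` modulo `p`, including the
point at infinity (`Affine.Point` contains only nonsingular points and the point at infinity). -/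
noncomputable def numNonsingular (W : WeierstrassCurve ℚ_[p])
    [WeierstrassCurve.IsIntegral ℤ_[p] W] : ℕ :=
  Nat.card (reductionMod p W).toAffine.Point

/-- The points of `W(ℚ_p)` with nonsingular reduction with respect to the equation `W`. A point
`(x, y)` with `x ∉ ℤ_p` reduces to the point at infinity, which is nonsingular; a point with
coordinates in `ℤ_p` reduces to the point whose coordinates are the residue classes. -/
def HasNonsingularReduction (W : WeierstrassCurve ℚ_[p])
    [WeierstrassCurve.IsIntegral ℤ_[p] W] : W.toAffine.Point → Prop
  | .zero => True
  | .some x y _ => 1 < ‖x‖ ∨ ∃ a b : ℤ_[p], (a : ℚ_[p]) = x ∧ (b : ℚ_[p]) = y ∧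
      (reductionMod p W).toAffine.Nonsingular (PadicInt.toZMod a) (PadicInt.toZMod b)

/-- For `n ≥ 1`, the image of `p ^ n ℤ_p` in `W(ℚ_p)` under the formal group of `W`: the points
which reduce to the point at infinity and whose parameter `z = -x / y` lies in `p ^ n ℤ_p`. -/
def InFormalGroup (W : WeierstrassCurve ℚ_[p]) (n : ℕ) : W.toAffine.Point → Prop
  | .zero => True
  | .some x y _ => 1 < ‖x‖ ∧ ‖-x / y‖ ≤ (p : ℝ) ^ (-(n : ℤ))

/-- The set `W^n(ℚ_p)`: the points with nonsingular reduction if `n = 0`, and the `n`-th step of the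
formal group filtration if `n ≥ 1`. -/
def filtration (W : WeierstrassCurve ℚ_[p])
    [WeierstrassCurve.IsIntegral ℤ_[p] W] : ℕ → Set W.toAffine.Point
  | 0 => {P | HasNonsingularReduction p W P}
  | n + 1 => {P | InFormalGroup p W (n + 1) P}

end PadicFiltration

/-! Comparing discriminants with a minimal equation forces `v(u) = k ≥ 1`, and `r`, `s`, `t` are
then roots of monic polynomials over `ℤ_p`, hence integral. The substitution sends lines to lines,
so it is a group isomorphism.

For `n ≥ 1` the step `W^n` is the set `|x| ≥ p^(2n)` (plus `O`), because `|y|² = |x|³` outside the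
unit ball; with `x = u²x' + r` this becomes `|x'| ≥ p^(2(n+k))`. For `n = 0`, all coefficients of
`E` vanish modulo `p` after an integral translation, so `E` reduces to a translate of the cusp `Y² =
X³`. Its nonsingular affine points are those with `X ≠ 0`, and the condition becomes `|u²x'| ≥ 1`,
that is `|x'| ≥ p^(2k)`. Both cases are in `pointEquivOfSMulEq_mem_filtration_iff`.

The same shift, applied to the equation `scale W m` with `u = p^m`, replaces formal group theory:
`W^m` and `W^(m+1)` become steps `0` and `1` of `scale W m`. Closure of `W^m` under addition thus
follows from the addition formulas on integral points. Likewise `W^m / W^(m+1)` is counted by the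
nonsingular points of a cusp, of which there are `p`, while `W^0 / W^1` has `N_p` elements by
Hensel's lemma.

The index `c_p` is finite because `Δ` lies in the ideal generated by the equation and its partial
derivatives: integral points that agree modulo a high enough power of `p` differ by an element of
`W^1` (`sub_mem_filtration_one`). -/

namespace WeierstrassCurve

/-! ### Changes of coordinates as group isomorphisms -/

section VariableChangePoint

variable {F : Type*} [Field F] {E E' : WeierstrassCurve F} {C : VariableChange F}

namespace VariableChange

/-- The old `x`-coordinate of a point in terms of its new coordinates. -/
def mapX (C : VariableChange F) (x : F) : F := (C.u : F) ^ 2 * x + C.r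

/-- The old `y`-coordinate of a point in terms of its new coordinates. -/
def mapY (C : VariableChange F) (x y : F) : F :=
  (C.u : F) ^ 3 * y + (C.u : F) ^ 2 * C.s * x + C.t

lemma mapX_inj (C : VariableChange F) {x₁ x₂ : F} : C.mapX x₁ = C.mapX x₂ ↔ x₁ = x₂ := by
  simp [mapX]

lemma mapY_inj (C : VariableChange F) {x y₁ y₂ : F} : C.mapY x y₁ = C.mapY x y₂ ↔ y₁ = y₂ := by
  simp [mapY]

end VariableChange

lemma a₁_of_smul_eq (h : C • E = E') : E.a₁ = C.u * E'.a₁ - 2 * C.s := by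
  subst h; simp only [variableChange_a₁, Units.val_inv_eq_inv_val]; field_simp; ring

lemma a₂_of_smul_eq (h : C • E = E') :
    E.a₂ = (C.u : F) ^ 2 * E'.a₂ + C.s * E.a₁ - 3 * C.r + C.s ^ 2 := by
  subst h; simp only [variableChange_a₂, Units.val_inv_eq_inv_val]; field_simp; ring

lemma a₃_of_smul_eq (h : C • E = E') :
    E.a₃ = (C.u : F) ^ 3 * E'.a₃ - C.r * E.a₁ - 2 * C.t := by
  subst h; simp only [variableChange_a₃, Units.val_inv_eq_inv_val]; field_simp; ring

lemma a₄_of_smul_eq (h : C • E = E') :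
    E.a₄ = (C.u : F) ^ 4 * E'.a₄ + C.s * E.a₃ - 2 * C.r * E.a₂ + (C.t + C.r * C.s) * E.a₁
      - 3 * C.r ^ 2 + 2 * C.s * C.t := by
  subst h; simp only [variableChange_a₄, Units.val_inv_eq_inv_val]; field_simp; ring

lemma a₆_of_smul_eq (h : C • E = E') :
    E.a₆ = (C.u : F) ^ 6 * E'.a₆ - C.r * E.a₄ - C.r ^ 2 * E.a₂ - C.r ^ 3 + C.t * E.a₃ + C.t ^ 2
      + C.r * C.t * E.a₁ := by
  subst h; simp only [variableChange_a₆, Units.val_inv_eq_inv_val]; field_simp; ring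

lemma equation_of_smul_eq (h : C • E = E') (x y : F) :
    E.toAffine.Equation (C.mapX x) (C.mapY x y) ↔ E'.toAffine.Equation x y := by
  rw [Affine.equation_iff', Affine.equation_iff',
    ← mul_eq_zero_iff_left (a := (C.u : F) ^ 6) (b := _ - (x ^ 3 + _ + _ + _))
      (pow_ne_zero 6 C.u.ne_zero)]
  rw [a₆_of_smul_eq h, a₄_of_smul_eq h, a₃_of_smul_eq h, a₂_of_smul_eq h, a₁_of_smul_eq h,
    VariableChange.mapX, VariableChange.mapY]
  refine Eq.congr_left ?_
  ring

lemma evalEval_polynomialY_of_smul_eq (h : C • E = E') (x y : F) :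
    2 * C.mapY x y + E.a₁ * C.mapX x + E.a₃ =
      (C.u : F) ^ 3 * (2 * y + E'.a₁ * x + E'.a₃) := by
  rw [a₃_of_smul_eq h, a₁_of_smul_eq h, VariableChange.mapX, VariableChange.mapY]
  ring

/-- The gradient transforms by a triangular matrix with diagonal entries `u⁴` and `u³`, so its
vanishing does not depend on the coordinates. -/
lemma evalEval_polynomialX_of_smul_eq (h : C • E = E') (x y : F) :
    E.a₁ * C.mapY x y - (3 * C.mapX x ^ 2 + 2 * E.a₂ * C.mapX x + E.a₄) =
      (C.u : F) ^ 4 * (E'.a₁ * y - (3 * x ^ 2 + 2 * E'.a₂ * x + E'.a₄))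
        - C.s * ((C.u : F) ^ 3 * (2 * y + E'.a₁ * x + E'.a₃)) := by
  rw [a₄_of_smul_eq h, a₃_of_smul_eq h, a₂_of_smul_eq h, a₁_of_smul_eq h, VariableChange.mapX,
    VariableChange.mapY]
  ring

lemma nonsingular_of_smul_eq (h : C • E = E') (x y : F) :
    E.toAffine.Nonsingular (C.mapX x) (C.mapY x y) ↔ E'.toAffine.Nonsingular x y := by
  rw [Affine.nonsingular_iff', Affine.nonsingular_iff', equation_of_smul_eq h,
    evalEval_polynomialX_of_smul_eq h, evalEval_polynomialY_of_smul_eq h]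
  refine and_congr_right fun _ ↦ ?_
  by_cases hy : 2 * y + E'.a₁ * x + E'.a₃ = 0 <;> simp [hy]

lemma negY_of_smul_eq (h : C • E = E') (x y : F) :
    E.toAffine.negY (C.mapX x) (C.mapY x y) = C.mapY x (E'.toAffine.negY x y) := by
  simp only [Affine.negY]
  rw [a₃_of_smul_eq h, a₁_of_smul_eq h, VariableChange.mapX, VariableChange.mapY,
    VariableChange.mapY]
  ring

variable [DecidableEq F]

/-- A line of slope `ℓ` in the new coordinates has slope `uℓ + s` in the old ones; this makes the
map compatible with addition. -/
lemma slope_of_smul_eq (h : C • E = E') {x₁ x₂ y₁ y₂ : F} (h₁ : E'.toAffine.Equation x₁ y₁)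
    (h₂ : E'.toAffine.Equation x₂ y₂) (hxy : ¬(x₁ = x₂ ∧ y₁ = E'.toAffine.negY x₂ y₂)) :
    E.toAffine.slope (C.mapX x₁) (C.mapX x₂) (C.mapY x₁ y₁) (C.mapY x₂ y₂) =
      C.u * E'.toAffine.slope x₁ x₂ y₁ y₂ + C.s := by
  have hu : (C.u : F) ≠ 0 := C.u.ne_zero
  by_cases hx : x₁ = x₂
  · subst hx
    have hy : y₁ ≠ E'.toAffine.negY x₁ y₂ := fun hy ↦ hxy ⟨rfl, hy⟩
    obtain rfl : y₁ = y₂ := Affine.Y_eq_of_Y_ne h₁ h₂ rfl hy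
    have hd : 2 * y₁ + E'.a₁ * x₁ + E'.a₃ ≠ 0 := by
      intro h0
      refine hy ?_
      rw [Affine.negY]
      linear_combination h0
    rw [Affine.slope_of_Y_ne rfl hy, Affine.slope_of_Y_ne rfl
      (by rwa [negY_of_smul_eq h, Ne, C.mapY_inj])]
    have e₁ : C.mapY x₁ y₁ - E.toAffine.negY (C.mapX x₁) (C.mapY x₁ y₁) =
        (C.u : F) ^ 3 * (2 * y₁ + E'.a₁ * x₁ + E'.a₃) := by
      rw [← evalEval_polynomialY_of_smul_eq h, Affine.negY]
      ring
    have e₂ : y₁ - E'.toAffine.negY x₁ y₁ = 2 * y₁ + E'.a₁ * x₁ + E'.a₃ := by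
      rw [Affine.negY]
      ring
    rw [e₁, e₂]
    field_simp
    linear_combination -evalEval_polynomialX_of_smul_eq h x₁ y₁
  · rw [Affine.slope_of_X_ne hx, Affine.slope_of_X_ne (by rwa [Ne, C.mapX_inj])]
    have := sub_ne_zero.mpr hx
    have e : C.mapX x₁ - C.mapX x₂ = (C.u : F) ^ 2 * (x₁ - x₂) := by
      rw [VariableChange.mapX, VariableChange.mapX]
      ring
    rw [e, VariableChange.mapY, VariableChange.mapY]
    field_simp
    ring

/-- The map on points defined by a change of coordinates, from the new curve to the old one. -/
def pointMapOfSMulEq (h : C • E = E') : E'.toAffine.Point → E.toAffine.Point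
  | .zero => .zero
  | .some x y hxy => .some (C.mapX x) (C.mapY x y) ((nonsingular_of_smul_eq h x y).mpr hxy)

lemma pointMapOfSMulEq_add (h : C • E = E') (P Q : E'.toAffine.Point) :
    pointMapOfSMulEq h (P + Q) = pointMapOfSMulEq h P + pointMapOfSMulEq h Q := by
  rcases P with _ | ⟨x₁, y₁, h₁⟩
  · exact (congrArg _ (zero_add Q)).trans (zero_add _).symm
  rcases Q with _ | ⟨x₂, y₂, h₂⟩
  · exact (congrArg _ (add_zero (Affine.Point.some x₁ y₁ h₁))).trans (add_zero _).symm
  by_cases hxy : x₁ = x₂ ∧ y₁ = E'.toAffine.negY x₂ y₂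
  · rw [Affine.Point.add_of_Y_eq hxy.1 hxy.2]
    simp only [pointMapOfSMulEq]
    rw [Affine.Point.add_of_Y_eq (by rw [hxy.1])
      (by rw [negY_of_smul_eq h, hxy.2, hxy.1])]
    rfl
  · have hxy' : ¬(C.mapX x₁ = C.mapX x₂ ∧
        C.mapY x₁ y₁ = E.toAffine.negY (C.mapX x₂) (C.mapY x₂ y₂)) := by
      rw [C.mapX_inj, negY_of_smul_eq h]
      rintro ⟨rfl, hy⟩
      exact hxy ⟨rfl, C.mapY_inj.mp hy⟩
    rw [Affine.Point.add_some hxy]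
    simp only [pointMapOfSMulEq]
    rw [Affine.Point.add_some hxy']
    simp only [slope_of_smul_eq h h₁.1 h₂.1 hxy]
    set ℓ := E'.toAffine.slope x₁ x₂ y₁ y₂
    have hX : C.mapX (E'.toAffine.addX x₁ x₂ ℓ) =
        E.toAffine.addX (C.mapX x₁) (C.mapX x₂) (C.u * ℓ + C.s) := by
      rw [Affine.addX, Affine.addX, a₂_of_smul_eq h, a₁_of_smul_eq h, VariableChange.mapX,
        VariableChange.mapX, VariableChange.mapX]
      ring
    have hY : C.mapY (E'.toAffine.addX x₁ x₂ ℓ) (E'.toAffine.addY x₁ x₂ y₁ ℓ) =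
        E.toAffine.addY (C.mapX x₁) (C.mapX x₂) (C.mapY x₁ y₁) (C.u * ℓ + C.s) := by
      rw [Affine.addY, Affine.addY, Affine.negAddY, Affine.negAddY, ← hX, ← negY_of_smul_eq h]
      congr 1
      rw [VariableChange.mapY, VariableChange.mapY, VariableChange.mapX, VariableChange.mapX]
      ring
    congr 1

omit [DecidableEq F] in
lemma pointMapOfSMulEq_bijective (h : C • E = E') : Function.Bijective (pointMapOfSMulEq h) := by
  constructor
  · rintro (_ | ⟨x₁, y₁, h₁⟩) (_ | ⟨x₂, y₂, h₂⟩) hPQ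
    · rfl
    · cases hPQ
    · cases hPQ
    · simp only [pointMapOfSMulEq, Affine.Point.some.injEq, C.mapX_inj] at hPQ
      obtain ⟨rfl, hy⟩ := hPQ
      obtain rfl := C.mapY_inj.mp hy
      rfl
  · rintro (_ | ⟨X, Y, hXY⟩)
    · exact ⟨.zero, rfl⟩
    · have hu : (C.u : F) ≠ 0 := C.u.ne_zero
      obtain ⟨x, rfl⟩ : ∃ x, C.mapX x = X := ⟨(X - C.r) / (C.u : F) ^ 2, by
        rw [VariableChange.mapX]; field_simp; ring⟩
      obtain ⟨y, rfl⟩ : ∃ y, C.mapY x y = Y :=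
        ⟨(Y - (C.u : F) ^ 2 * C.s * x - C.t) / (C.u : F) ^ 3, by
          rw [VariableChange.mapY]; field_simp; ring⟩
      exact ⟨.some x y ((nonsingular_of_smul_eq h x y).mp hXY), rfl⟩

/-- The isomorphism of groups of points defined by a change of coordinates, from the new curve to
the old one. -/
noncomputable def pointEquivOfSMulEq (h : C • E = E') : E'.toAffine.Point ≃+ E.toAffine.Point :=
  AddEquiv.ofBijective (AddMonoidHom.mk' (pointMapOfSMulEq h) (pointMapOfSMulEq_add h))
    (pointMapOfSMulEq_bijective h)

lemma pointEquivOfSMulEq_some (h : C • E = E') {x y : F} (hxy : E'.toAffine.Nonsingular x y) :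
    pointEquivOfSMulEq h (.some x y hxy) =
      .some (C.mapX x) (C.mapY x y) ((nonsingular_of_smul_eq h x y).mpr hxy) :=
  rfl

end VariableChangePoint

end WeierstrassCurve

namespace WeierstrassCurve.Affine

/-- One expression serves chord and tangent. It remains usable when `x₁ - x₂` is nonzero but not a
unit, where the chord formula cannot be reduced modulo `p`. -/
lemma slope_eq_div {F : Type*} [Field F] [DecidableEq F] {W : Affine F} {x₁ x₂ y₁ y₂ : F}
    (h₁ : W.Equation x₁ y₁) (h₂ : W.Equation x₂ y₂) (hy : y₁ ≠ W.negY x₂ y₂) :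
    W.slope x₁ x₂ y₁ y₂ =
      (x₁ ^ 2 + x₁ * x₂ + x₂ ^ 2 + W.a₂ * (x₁ + x₂) + W.a₄ - W.a₁ * y₁) /
        (y₁ - W.negY x₂ y₂) := by
  by_cases hx : x₁ = x₂
  · subst hx
    obtain rfl := Y_eq_of_Y_ne h₁ h₂ rfl hy
    rw [slope_of_Y_ne rfl hy]
    congr 1
    ring
  · rw [slope_of_X_ne hx, div_eq_div_iff (sub_ne_zero.mpr hx) (sub_ne_zero.mpr hy), negY]
    rw [equation_iff'] at h₁ h₂
    linear_combination h₁ - h₂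

end WeierstrassCurve.Affine

/-! ### Reduction modulo `p` and sizes of coordinates -/

namespace PadicFiltration

open WeierstrassCurve Polynomial

variable {p : ℕ} [Fact p.Prime]

lemma toZMod_eq_zero_iff (a : ℤ_[p]) : PadicInt.toZMod a = 0 ↔ ‖(a : ℚ_[p])‖ < 1 := by
  rw [← RingHom.mem_ker, PadicInt.ker_toZMod, IsLocalRing.mem_maximalIdeal, PadicInt.mem_nonunits,
    PadicInt.norm_def]

lemma toZMod_eq_iff (a b : ℤ_[p]) :
    PadicInt.toZMod a = PadicInt.toZMod b ↔ ‖(a : ℚ_[p]) - b‖ < 1 := by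
  rw [← sub_eq_zero, ← map_sub, toZMod_eq_zero_iff, PadicInt.coe_sub]

lemma toZMod_ne_zero_iff (a : ℤ_[p]) : PadicInt.toZMod a ≠ 0 ↔ 1 ≤ ‖(a : ℚ_[p])‖ := by
  rw [Ne, toZMod_eq_zero_iff, not_lt]

lemma coe_two : ((2 : ℤ_[p]) : ℚ_[p]) = 2 := rfl

lemma coe_three : ((3 : ℤ_[p]) : ℚ_[p]) = 3 := rfl

lemma toZMod_two : PadicInt.toZMod (2 : ℤ_[p]) = 2 := map_ofNat _ 2

lemma toZMod_three : PadicInt.toZMod (3 : ℤ_[p]) = 3 := map_ofNat _ 3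

lemma toZMod_surjective : Function.Surjective (PadicInt.toZMod (p := p)) := fun a ↦
  ⟨a.val, by rw [map_natCast, ZMod.natCast_zmod_val]⟩

lemma exists_div_eq (a b : ℤ_[p]) (hb : PadicInt.toZMod b ≠ 0) :
    ∃ c : ℤ_[p], (a : ℚ_[p]) / b = c ∧ PadicInt.toZMod a / PadicInt.toZMod b =
      PadicInt.toZMod c := by
  obtain ⟨u, rfl⟩ : IsUnit b := by
    by_contra h
    exact hb ((toZMod_eq_zero_iff b).mpr (PadicInt.not_isUnit_iff.mp h))
  have hu : ((u : ℤ_[p]) : ℚ_[p]) ≠ 0 := PadicInt.coe_ne_zero.mpr u.ne_zero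
  refine ⟨a * (u⁻¹ : ℤ_[p]ˣ), ?_, ?_⟩
  · rw [div_eq_iff hu, ← PadicInt.coe_mul, mul_assoc, Units.inv_mul, mul_one]
  · rw [div_eq_iff hb, ← map_mul, mul_assoc, Units.inv_mul, mul_one]

lemma norm_le_one_of_aeval_eq_zero {f : ℤ_[p][X]} (hf : f.Monic) {y : ℚ_[p]}
    (hy : aeval y f = 0) : ‖y‖ ≤ 1 := by
  have : _root_.IsIntegral ℤ_[p] y := ⟨f, hf, hy⟩
  obtain ⟨z, rfl⟩ := IsIntegrallyClosed.isIntegral_iff.mp this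
  exact z.2

lemma norm_add_lt {a b : ℚ_[p]} {c : ℝ} (ha : ‖a‖ < c) (hb : ‖b‖ < c) : ‖a + b‖ < c :=
  (Padic.nonarchimedean a b).trans_lt (max_lt ha hb)

lemma norm_add_le' {a b : ℚ_[p]} {c : ℝ} (ha : ‖a‖ ≤ c) (hb : ‖b‖ ≤ c) : ‖a + b‖ ≤ c :=
  (Padic.nonarchimedean a b).trans (max_le ha hb)

lemma norm_add_eq_left {a b : ℚ_[p]} (h : ‖b‖ < ‖a‖) : ‖a + b‖ = ‖a‖ := by
  rw [Padic.add_eq_max_of_ne h.ne', max_eq_left h.le]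

lemma norm_mul_lt {a b : ℚ_[p]} {c : ℝ} (ha : ‖a‖ ≤ 1) (hb : ‖b‖ < c) : ‖a * b‖ < c := by
  rw [norm_mul]
  exact (mul_le_of_le_one_left (norm_nonneg b) ha).trans_lt hb

variable {W : WeierstrassCurve ℚ_[p]}

section Integral

variable [WeierstrassCurve.IsIntegral ℤ_[p] W]

lemma coe_a₁ : ((integralModel ℤ_[p] W).a₁ : ℚ_[p]) = W.a₁ := by
  rw [← PadicInt.algebraMap_apply, integralModel_a₁_eq]
lemma coe_a₂ : ((integralModel ℤ_[p] W).a₂ : ℚ_[p]) = W.a₂ := by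
  rw [← PadicInt.algebraMap_apply, integralModel_a₂_eq]
lemma coe_a₃ : ((integralModel ℤ_[p] W).a₃ : ℚ_[p]) = W.a₃ := by
  rw [← PadicInt.algebraMap_apply, integralModel_a₃_eq]
lemma coe_a₄ : ((integralModel ℤ_[p] W).a₄ : ℚ_[p]) = W.a₄ := by
  rw [← PadicInt.algebraMap_apply, integralModel_a₄_eq]
lemma coe_a₆ : ((integralModel ℤ_[p] W).a₆ : ℚ_[p]) = W.a₆ := by
  rw [← PadicInt.algebraMap_apply, integralModel_a₆_eq]

variable (W) in
lemma norm_a₁_le : ‖W.a₁‖ ≤ 1 := by rw [← coe_a₁]; exact PadicInt.norm_le_one _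
variable (W) in
lemma norm_a₂_le : ‖W.a₂‖ ≤ 1 := by rw [← coe_a₂]; exact PadicInt.norm_le_one _
variable (W) in
lemma norm_a₃_le : ‖W.a₃‖ ≤ 1 := by rw [← coe_a₃]; exact PadicInt.norm_le_one _
variable (W) in
lemma norm_a₄_le : ‖W.a₄‖ ≤ 1 := by rw [← coe_a₄]; exact PadicInt.norm_le_one _
variable (W) in
lemma norm_a₆_le : ‖W.a₆‖ ≤ 1 := by rw [← coe_a₆]; exact PadicInt.norm_le_one _

lemma equation_integralModel (a b : ℤ_[p]) :
    (integralModel ℤ_[p] W).toAffine.Equation a b ↔ W.toAffine.Equation (a : ℚ_[p]) (b : ℚ_[p]) := by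
  conv_rhs => rw [← baseChange_integralModel_eq ℤ_[p] W]
  exact (Affine.map_equation _ (f := algebraMap ℤ_[p] ℚ_[p]) Subtype.coe_injective a b).symm

lemma equation_reductionMod {a b : ℤ_[p]} (h : W.toAffine.Equation (a : ℚ_[p]) (b : ℚ_[p])) :
    (reductionMod p W).toAffine.Equation (PadicInt.toZMod a) (PadicInt.toZMod b) :=
  ((equation_integralModel a b).mpr h).map _

lemma norm_Y_le_one {x y : ℚ_[p]} (h : W.toAffine.Equation x y) (hx : ‖x‖ ≤ 1) : ‖y‖ ≤ 1 := by
  obtain ⟨x, rfl⟩ : ∃ a : ℤ_[p], (a : ℚ_[p]) = x := ⟨⟨x, hx⟩, rfl⟩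
  set V := integralModel ℤ_[p] W
  have hf : (X ^ 2 + C (V.a₁ * x + V.a₃) * X -
      C (x ^ 3 + V.a₂ * x ^ 2 + V.a₄ * x + V.a₆)).Monic := by
    monicity!
  refine norm_le_one_of_aeval_eq_zero hf ?_
  rw [Affine.equation_iff'] at h
  simp only [map_sub, map_add, map_mul, map_pow, aeval_X, aeval_C, PadicInt.algebraMap_apply, V,
    coe_a₁, coe_a₂, coe_a₃, coe_a₄, coe_a₆]
  linear_combination h

lemma norm_Y_sq {x y : ℚ_[p]} (h : W.toAffine.Equation x y) (hx : 1 < ‖x‖) :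
    ‖y‖ ^ 2 = ‖x‖ ^ 3 := by
  have hx0 : 0 < ‖x‖ := zero_lt_one.trans hx
  have hr : ‖x ^ 3 + (W.a₂ * x ^ 2 + (W.a₄ * x + W.a₆))‖ = ‖x‖ ^ 3 := by
    rw [norm_add_eq_left, norm_pow]
    rw [norm_pow]
    refine norm_add_lt (norm_mul_lt (norm_a₂_le W) ?_) (norm_add_lt (norm_mul_lt (norm_a₄_le W) ?_)
      ((norm_a₆_le W).trans_lt ?_))
    · rw [norm_pow]; exact pow_lt_pow_right₀ hx (by norm_num)
    · exact lt_self_pow₀ hx (by norm_num)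
    · exact one_lt_pow₀ hx (by norm_num)
  have he : y ^ 2 + (W.a₁ * (x * y) + W.a₃ * y) =
      x ^ 3 + (W.a₂ * x ^ 2 + (W.a₄ * x + W.a₆)) := by
    rw [Affine.equation_iff] at h
    linear_combination h
  rw [← hr, ← he]
  -- Otherwise the left side has norm at most `|x|²`, less than the norm `|x|³` of the right side.
  -- Once `|y| > |x|`, the term `y²` dominates.
  have hxy : ‖x‖ < ‖y‖ := by
    by_contra! hyx
    have hle : ‖y ^ 2 + (W.a₁ * (x * y) + W.a₃ * y)‖ ≤ ‖x‖ ^ 2 := by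
      refine norm_add_le' ?_ (norm_add_le' ?_ ?_)
      · rw [norm_pow]; gcongr
      · rw [norm_mul, norm_mul, sq]
        exact (mul_le_of_le_one_left (by positivity) (norm_a₁_le W)).trans (by gcongr)
      · rw [norm_mul]
        refine (mul_le_of_le_one_left (norm_nonneg y) (norm_a₃_le W)).trans (hyx.trans ?_)
        exact le_self_pow₀ hx.le (by norm_num)
    rw [he, hr] at hle
    exact absurd hle (not_le.mpr (pow_lt_pow_right₀ hx (by norm_num)))
  rw [norm_add_eq_left, norm_pow]
  have hy1 : 1 < ‖y‖ := hx.trans hxy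
  rw [norm_pow]
  refine norm_add_lt (norm_mul_lt (norm_a₁_le W) ?_) (norm_mul_lt (norm_a₃_le W) ?_)
  · rw [norm_mul, sq]; gcongr
  · exact lt_self_pow₀ hy1 (by norm_num)

/-- `|x| = |y/x|²`, so `|x|` is an even power of `p`. -/
lemma exists_norm_X_eq {x y : ℚ_[p]} (h : W.toAffine.Equation x y) (hx : 1 < ‖x‖) :
    ∃ m : ℕ, 1 ≤ m ∧ ‖x‖ = (p : ℝ) ^ (2 * m) := by
  have hx0 : 0 < ‖x‖ := zero_lt_one.trans hx
  have hp : (1 : ℝ) < p := mod_cast (Fact.out : p.Prime).one_lt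
  have hsq : ‖y / x‖ ^ 2 = ‖x‖ := by
    rw [norm_div, div_pow, norm_Y_sq h hx]
    field_simp
  have h0 : y / x ≠ 0 := by
    rintro h0
    rw [h0, norm_zero] at hsq
    norm_num at hsq
    exact hx0.ne hsq
  have hv := Padic.norm_eq_zpow_neg_valuation h0
  have hpos : 0 < -(y / x).valuation := by
    rw [← one_lt_zpow_iff_right₀ hp, ← hv]
    by_contra! hle
    exact absurd (pow_le_one₀ (norm_nonneg _) hle) (by rw [hsq]; exact not_le.mpr hx)
  obtain ⟨m, hm⟩ := Int.eq_ofNat_of_zero_le hpos.le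
  refine ⟨m, by omega, ?_⟩
  rw [← hsq, hv, hm, zpow_natCast, ← pow_mul, mul_comm]

/-- The parameter satisfies `|z|² = |x|⁻¹`. From here on the filtration is a condition on `|x|`
alone. -/
lemma inFormalGroup_some_iff {n : ℕ} (hn : 1 ≤ n) {x y : ℚ_[p]} (h : W.toAffine.Nonsingular x y) :
    InFormalGroup p W n (.some x y h) ↔ (p : ℝ) ^ (2 * n) ≤ ‖x‖ := by
  have hp : (1 : ℝ) < p := mod_cast (Fact.out : p.Prime).one_lt
  have hp0 : (0 : ℝ) < p := zero_lt_one.trans hp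
  have key (hx : 1 < ‖x‖) : ‖-x / y‖ ^ 2 = ‖x‖⁻¹ := by
    have hx0 : 0 < ‖x‖ := zero_lt_one.trans hx
    rw [norm_div, div_pow, norm_Y_sq h.1 hx, norm_neg]
    field_simp
  have hone : (1 : ℝ) < (p : ℝ) ^ (2 * n) := one_lt_pow₀ hp (by omega)
  change 1 < ‖x‖ ∧ ‖-x / y‖ ≤ (p : ℝ) ^ (-(n : ℤ)) ↔ _
  have main (hx : 1 < ‖x‖) : ‖-x / y‖ ≤ (p : ℝ) ^ (-(n : ℤ)) ↔ (p : ℝ) ^ (2 * n) ≤ ‖x‖ := by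
    rw [← pow_le_pow_iff_left₀ (norm_nonneg _) (by positivity) two_ne_zero, key hx, zpow_neg,
      zpow_natCast, inv_pow, ← pow_mul, mul_comm n, inv_le_inv₀ (by linarith) (by linarith)]
  exact ⟨fun ⟨hx, hz⟩ ↦ (main hx).mp hz, fun hx ↦
    ⟨hone.trans_le hx, (main (hone.trans_le hx)).mpr hx⟩⟩

lemma hasNonsingularReduction_coe (a b : ℤ_[p]) (h : W.toAffine.Nonsingular (a : ℚ_[p]) b) :
    HasNonsingularReduction p W (.some a b h) ↔
      (reductionMod p W).toAffine.Nonsingular (PadicInt.toZMod a) (PadicInt.toZMod b) := by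
  constructor
  · rintro (ha | ⟨a', b', ha, hb, h'⟩)
    · exact absurd ha (not_lt.mpr a.2)
    · rwa [← PadicInt.ext ha, ← PadicInt.ext hb]
  · exact fun h' ↦ .inr ⟨a, b, rfl, rfl, h'⟩

lemma nonsingular_reductionMod_iff {a b : ℤ_[p]}
    (h : W.toAffine.Equation (a : ℚ_[p]) (b : ℚ_[p])) :
    (reductionMod p W).toAffine.Nonsingular (PadicInt.toZMod a) (PadicInt.toZMod b) ↔
      1 ≤ ‖W.a₁ * b - (3 * (a : ℚ_[p]) ^ 2 + 2 * W.a₂ * a + W.a₄)‖ ∨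
        1 ≤ ‖2 * (b : ℚ_[p]) + W.a₁ * a + W.a₃‖ := by
  set V := integralModel ℤ_[p] W with hV
  have e₁ := toZMod_ne_zero_iff (V.a₁ * b - (3 * a ^ 2 + 2 * V.a₂ * a + V.a₄))
  have e₂ := toZMod_ne_zero_iff (2 * b + V.a₁ * a + V.a₃)
  push_cast [coe_two, coe_three] at e₁ e₂
  rw [hV, coe_a₁, coe_a₂, coe_a₄, ← hV] at e₁
  rw [hV, coe_a₁, coe_a₃, ← hV] at e₂
  rw [← e₁, ← e₂, Affine.nonsingular_iff', and_iff_right (equation_reductionMod h)]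
  simp [reductionMod, V, toZMod_two, toZMod_three]

variable [DecidableEq ℚ_[p]]

lemma exists_slope_eq {x₁ x₂ y₁ y₂ : ℤ_[p]} (h₁ : W.toAffine.Equation (x₁ : ℚ_[p]) (y₁ : ℚ_[p]))
    (h₂ : W.toAffine.Equation (x₂ : ℚ_[p]) (y₂ : ℚ_[p]))
    (hxy : ¬(PadicInt.toZMod x₁ = PadicInt.toZMod x₂ ∧ PadicInt.toZMod y₁ =
      (reductionMod p W).toAffine.negY (PadicInt.toZMod x₂) (PadicInt.toZMod y₂))) :
    ∃ ℓ : ℤ_[p], W.toAffine.slope (x₁ : ℚ_[p]) x₂ y₁ y₂ = ℓ ∧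
      (reductionMod p W).toAffine.slope (PadicInt.toZMod x₁) (PadicInt.toZMod x₂)
        (PadicInt.toZMod y₁) (PadicInt.toZMod y₂) = PadicInt.toZMod ℓ := by
  by_cases hx : PadicInt.toZMod x₁ = PadicInt.toZMod x₂
  · have hy : PadicInt.toZMod y₁ ≠
        (reductionMod p W).toAffine.negY (PadicInt.toZMod x₂) (PadicInt.toZMod y₂) :=
      fun hy ↦ hxy ⟨hx, hy⟩
    set V := integralModel ℤ_[p] W with hV
    have hd : PadicInt.toZMod y₁ -
        (reductionMod p W).toAffine.negY (PadicInt.toZMod x₂) (PadicInt.toZMod y₂) =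
        PadicInt.toZMod (y₁ - V.toAffine.negY x₂ y₂) := by
      rw [map_sub, reductionMod, ← hV, ← Affine.map_negY]
    have hd' : (y₁ : ℚ_[p]) - W.toAffine.negY (x₂ : ℚ_[p]) y₂ =
        ((y₁ - V.toAffine.negY x₂ y₂ : ℤ_[p]) : ℚ_[p]) := by
      simp only [Affine.negY, hV]
      push_cast
      rw [coe_a₁, coe_a₃]
    have h0 : PadicInt.toZMod (y₁ - V.toAffine.negY x₂ y₂) ≠ 0 := by
      rw [← hd]
      exact sub_ne_zero.mpr hy
    obtain ⟨ℓ, hℓ, hℓ'⟩ := exists_div_eq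
      (x₁ ^ 2 + x₁ * x₂ + x₂ ^ 2 + V.a₂ * (x₁ + x₂) + V.a₄ - V.a₁ * y₁) _ h0
    refine ⟨ℓ, ?_, ?_⟩
    · rw [Affine.slope_eq_div h₁ h₂, hd', ← hℓ]
      · push_cast
        rw [hV, coe_a₁, coe_a₂, coe_a₄]
      · rw [← sub_ne_zero, hd']
        rintro h
        rw [PadicInt.coe_eq_zero] at h
        exact h0 (by rw [h, map_zero])
    · have n₁ := equation_reductionMod h₁
      have n₂ := equation_reductionMod h₂
      rw [Affine.slope_eq_div n₁ n₂ hy, hd, ← hℓ']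
      simp [reductionMod, hV]
  · obtain ⟨ℓ, hℓ, hℓ'⟩ := exists_div_eq (y₁ - y₂) (x₁ - x₂)
      (by rw [map_sub]; exact sub_ne_zero.mpr hx)
    refine ⟨ℓ, ?_, ?_⟩
    · rw [Affine.slope_of_X_ne (fun h ↦ hx (by rw [PadicInt.ext h])), ← hℓ]
      push_cast
      rfl
    · rw [Affine.slope_of_X_ne hx, ← hℓ', map_sub, map_sub]

/-- The sum of two points with integral coordinates whose reductions are not opposite has integral
coordinates, which reduce to those given by the addition formulas. -/
lemma exists_add_eq {x₁ x₂ y₁ y₂ : ℤ_[p]} (h₁ : W.toAffine.Nonsingular (x₁ : ℚ_[p]) (y₁ : ℚ_[p]))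
    (h₂ : W.toAffine.Nonsingular (x₂ : ℚ_[p]) (y₂ : ℚ_[p]))
    (hxy : ¬(PadicInt.toZMod x₁ = PadicInt.toZMod x₂ ∧ PadicInt.toZMod y₁ =
      (reductionMod p W).toAffine.negY (PadicInt.toZMod x₂) (PadicInt.toZMod y₂))) :
    ∃ (x₃ y₃ : ℤ_[p]) (h₃ : W.toAffine.Nonsingular (x₃ : ℚ_[p]) (y₃ : ℚ_[p])),
      Affine.Point.some _ _ h₁ + .some _ _ h₂ = .some _ _ h₃ ∧
      ((reductionMod p W).toAffine.Nonsingular (PadicInt.toZMod x₁) (PadicInt.toZMod y₁) →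
      (reductionMod p W).toAffine.Nonsingular (PadicInt.toZMod x₂) (PadicInt.toZMod y₂) →
      (reductionMod p W).toAffine.Nonsingular (PadicInt.toZMod x₃) (PadicInt.toZMod y₃)) := by
  obtain ⟨ℓ, hℓ, hℓ'⟩ := exists_slope_eq h₁.1 h₂.1 hxy
  have hxy' : ¬((x₁ : ℚ_[p]) = x₂ ∧ (y₁ : ℚ_[p]) = W.toAffine.negY (x₂ : ℚ_[p]) y₂) := by
    rintro ⟨hx, hy⟩
    refine hxy ⟨by rw [PadicInt.ext hx], ?_⟩
    rw [reductionMod, Affine.map_negY]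
    congr 1
    apply PadicInt.ext
    rw [hy, Affine.negY, Affine.negY]
    push_cast
    rw [coe_a₁, coe_a₃]
  set V := integralModel ℤ_[p] W with hV
  have hX : W.toAffine.addX (x₁ : ℚ_[p]) x₂ ℓ = (V.toAffine.addX x₁ x₂ ℓ : ℤ_[p]) := by
    simp only [Affine.addX, hV]
    push_cast
    rw [coe_a₁, coe_a₂]
  have hY : W.toAffine.addY (x₁ : ℚ_[p]) x₂ y₁ ℓ = (V.toAffine.addY x₁ x₂ y₁ ℓ : ℤ_[p]) := by
    simp only [Affine.addY, Affine.negAddY, Affine.negY, hX]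
    push_cast
    rw [hV, coe_a₁, coe_a₃]
  have h₃ := Affine.nonsingular_add h₁ h₂ hxy'
  rw [hℓ, hX, hY] at h₃
  refine ⟨_, _, h₃, ?_, fun n₁ n₂ ↦ ?_⟩
  · rw [Affine.Point.add_some hxy']
    congr 1
    · rw [hℓ, hX]
    · rw [hℓ, hY]
  · have := Affine.nonsingular_add n₁ n₂ hxy
    rwa [hℓ', reductionMod, Affine.map_addX, Affine.map_addY] at this

end Integral

end PadicFiltration

/-! ### Addition and the kernel of reduction -/

namespace PadicFiltration

open WeierstrassCurve Polynomial

variable {p : ℕ} [Fact p.Prime] {W : WeierstrassCurve ℚ_[p]}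

section Integral

variable [WeierstrassCurve.IsIntegral ℤ_[p] W]

lemma coe_negY (a b : ℤ_[p]) : W.toAffine.negY (a : ℚ_[p]) b =
    ((integralModel ℤ_[p] W).toAffine.negY a b : ℤ_[p]) := by
  simp only [Affine.negY]
  push_cast
  rw [coe_a₁, coe_a₃]

lemma zero_mem_filtration (n : ℕ) : (0 : W.toAffine.Point) ∈ filtration p W n := by
  cases n <;> exact trivial

lemma some_mem_filtration_iff {n : ℕ} (hn : 1 ≤ n) {x y : ℚ_[p]} (h : W.toAffine.Nonsingular x y) :
    .some x y h ∈ filtration p W n ↔ (p : ℝ) ^ (2 * n) ≤ ‖x‖ := by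
  obtain ⟨n, rfl⟩ := Nat.exists_eq_add_of_le' hn
  exact inFormalGroup_some_iff hn h

lemma some_mem_filtration_one_iff {x y : ℚ_[p]} (h : W.toAffine.Nonsingular x y) :
    .some x y h ∈ filtration p W 1 ↔ 1 < ‖x‖ := by
  refine ⟨fun hP ↦ hP.1, fun hx ↦ ?_⟩
  have hp : (1 : ℝ) ≤ p := mod_cast (Fact.out : p.Prime).one_le
  obtain ⟨m, hm, he⟩ := exists_norm_X_eq h.1 hx
  rw [some_mem_filtration_iff le_rfl, he]
  exact pow_le_pow_right₀ hp (by omega)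

lemma some_coe_mem_filtration_zero_iff (a b : ℤ_[p]) (h : W.toAffine.Nonsingular (a : ℚ_[p]) b) :
    .some _ _ h ∈ filtration p W 0 ↔
      (reductionMod p W).toAffine.Nonsingular (PadicInt.toZMod a) (PadicInt.toZMod b) :=
  hasNonsingularReduction_coe a b h

lemma some_coe_notMem_filtration_one (a b : ℤ_[p]) (h : W.toAffine.Nonsingular (a : ℚ_[p]) b) :
    .some _ _ h ∉ filtration p W 1 := by
  rw [some_mem_filtration_one_iff, not_lt]
  exact a.2

lemma filtration_antitone : Antitone (filtration p W) := by
  have hp : (1 : ℝ) ≤ p := mod_cast (Fact.out : p.Prime).one_le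
  refine antitone_nat_of_succ_le fun n ↦ ?_
  rintro (_ | ⟨x, y, h⟩) hP
  · exact zero_mem_filtration n
  rcases n with _ | n
  · exact .inl ((some_mem_filtration_one_iff h).mp hP)
  · rw [some_mem_filtration_iff (by omega)] at hP ⊢
    exact (pow_le_pow_right₀ hp (by omega)).trans hP

lemma mem_filtration_one_or_exists (P : W.toAffine.Point) :
    P ∈ filtration p W 1 ∨ ∃ (a b : ℤ_[p]) (h : W.toAffine.Nonsingular (a : ℚ_[p]) (b : ℚ_[p])),
      P = .some _ _ h := by
  rcases P with _ | ⟨x, y, h⟩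
  · exact .inl (zero_mem_filtration 1)
  by_cases hx : 1 < ‖x‖
  · exact .inl ((some_mem_filtration_one_iff h).mpr hx)
  · have hx := not_lt.mp hx
    exact .inr ⟨⟨x, hx⟩, ⟨y, norm_Y_le_one h.1 hx⟩, h, rfl⟩

lemma neg_mem_filtration {n : ℕ} {P : W.toAffine.Point} (hP : P ∈ filtration p W n) :
    -P ∈ filtration p W n := by
  rcases n with _ | n
  · rcases mem_filtration_one_or_exists P with h1 | ⟨a, b, h, rfl⟩
    · rcases P with _ | ⟨x, y, h⟩
      · exact hP
      · rw [some_mem_filtration_one_iff] at h1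
        exact .inl h1
    · rw [some_coe_mem_filtration_zero_iff] at hP
      rw [Affine.Point.neg_some]
      have h' := (Affine.nonsingular_neg _ _).mpr h
      simp only [coe_negY] at h' ⊢
      rw [some_coe_mem_filtration_zero_iff, ← Affine.map_negY]
      exact (Affine.nonsingular_neg _ _).mpr hP
  · rcases P with _ | ⟨x, y, h⟩
    · exact hP
    · rw [Affine.Point.neg_some, some_mem_filtration_iff (by omega)]
      rwa [some_mem_filtration_iff (by omega)] at hP

variable [DecidableEq ℚ_[p]]

/-- The slope is both `N / (y₁ - negY)` and `(y₁ - y₂) / (x₁ - x₂)`, where defined. Both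
denominators are smaller than `δ`; the numerators differ, up to sign, from the partial derivatives
at the first point by less than `δ`, so one of them has norm at least `δ`. The lemma is used with `δ
= 1` for nonsingular reduction and with `δ = |Δ|` for finiteness of the index. -/
lemma one_lt_norm_slope {x₁ x₂ y₁ y₂ : ℤ_[p]}
    (h₁ : W.toAffine.Equation (x₁ : ℚ_[p]) (y₁ : ℚ_[p]))
    (h₂ : W.toAffine.Equation (x₂ : ℚ_[p]) (y₂ : ℚ_[p]))
    (hxy : ¬((x₁ : ℚ_[p]) = x₂ ∧ (y₁ : ℚ_[p]) = W.toAffine.negY (x₂ : ℚ_[p]) y₂)) {δ : ℝ}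
    (hx : ‖(x₁ : ℚ_[p]) - x₂‖ < δ) (hy : ‖(y₁ : ℚ_[p]) - W.toAffine.negY (x₂ : ℚ_[p]) y₂‖ < δ)
    (hδ : δ ≤ ‖W.a₁ * y₁ - (3 * (x₁ : ℚ_[p]) ^ 2 + 2 * W.a₂ * x₁ + W.a₄)‖ ∨
      δ ≤ ‖2 * (y₁ : ℚ_[p]) + W.a₁ * x₁ + W.a₃‖) :
    1 < ‖W.toAffine.slope (x₁ : ℚ_[p]) x₂ y₁ y₂‖ := by
  have hδ0 : 0 < δ := (norm_nonneg _).trans_lt hx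
  rcases hδ with hδ | hδ
  · set N : ℚ_[p] := (x₁ : ℚ_[p]) ^ 2 + x₁ * x₂ + x₂ ^ 2 + W.a₂ * (x₁ + x₂) + W.a₄ - W.a₁ * y₁
      with hN
    have hNδ : δ ≤ ‖N‖ := by
      have e : W.a₁ * y₁ - (3 * (x₁ : ℚ_[p]) ^ 2 + 2 * W.a₂ * x₁ + W.a₄) =
          -N + (2 * x₁ + x₂ + W.a₂ : ℚ_[p]) * -(x₁ - x₂ : ℚ_[p]) := by
        rw [hN]
        ring
      by_contra! hlt
      refine absurd hδ (not_le.mpr ?_)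
      rw [e]
      refine norm_add_lt (by rwa [norm_neg]) (norm_mul_lt ?_ (by rwa [norm_neg]))
      rw [← coe_a₂, ← coe_two, ← PadicInt.coe_mul, ← PadicInt.coe_add, ← PadicInt.coe_add]
      exact PadicInt.norm_le_one _
    have hN0 : N ≠ 0 := by
      rintro h0
      rw [h0, norm_zero] at hNδ
      exact hδ0.not_ge hNδ
    have hy0 : (y₁ : ℚ_[p]) ≠ W.toAffine.negY (x₂ : ℚ_[p]) y₂ := by
      intro hy0
      have hx0 : (x₁ - x₂ : ℚ_[p]) * N = 0 := by
        rw [Affine.equation_iff'] at h₁ h₂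
        rw [Affine.negY] at hy0
        rw [hN]
        linear_combination h₂ - h₁ + (y₁ - y₂ : ℚ_[p]) * hy0
      exact hxy ⟨sub_eq_zero.mp ((mul_eq_zero_iff_right hN0).mp hx0), hy0⟩
    rw [Affine.slope_eq_div h₁ h₂ hy0, norm_div,
      one_lt_div (norm_pos_iff.mpr (sub_ne_zero.mpr hy0))]
    exact hy.trans_le hNδ
  · have hyδ : δ ≤ ‖(y₁ - y₂ : ℚ_[p])‖ := by
      have e : 2 * (y₁ : ℚ_[p]) + W.a₁ * x₁ + W.a₃ = (y₁ - y₂ : ℚ_[p]) +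
          ((y₁ - W.toAffine.negY (x₂ : ℚ_[p]) y₂ : ℚ_[p]) + W.a₁ * (x₁ - x₂ : ℚ_[p])) := by
        rw [Affine.negY]
        ring
      by_contra! hlt
      refine absurd hδ (not_le.mpr ?_)
      rw [e]
      exact norm_add_lt hlt (norm_add_lt hy (norm_mul_lt (norm_a₁_le W) hx))
    have hx0 : (x₁ : ℚ_[p]) ≠ x₂ := by
      intro hx0
      have hy0 := Affine.Y_eq_of_Y_ne h₁ h₂ hx0 fun hy0 ↦ hxy ⟨hx0, hy0⟩
      rw [hy0, sub_self, norm_zero] at hyδ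
      exact hδ0.not_ge hyδ
    rw [Affine.slope_of_X_ne hx0, norm_div, one_lt_div (norm_pos_iff.mpr (sub_ne_zero.mpr hx0))]
    exact hx.trans_le hyδ

omit [DecidableEq ℚ_[p]] in
lemma one_lt_norm_addX (x₁ x₂ : ℤ_[p]) {ℓ : ℚ_[p]} (hℓ : 1 < ‖ℓ‖) :
    1 < ‖W.toAffine.addX (x₁ : ℚ_[p]) x₂ ℓ‖ := by
  have e : W.toAffine.addX (x₁ : ℚ_[p]) x₂ ℓ = ℓ ^ 2 + (W.a₁ * ℓ + -(W.a₂ + x₁ + x₂)) := by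
    rw [Affine.addX]
    ring
  have h1 : 1 < ‖ℓ‖ ^ 2 := one_lt_pow₀ hℓ two_ne_zero
  rw [e, norm_add_eq_left, norm_pow]
  · exact h1
  · rw [norm_pow]
    refine norm_add_lt (norm_mul_lt (norm_a₁_le W) (lt_self_pow₀ hℓ (by norm_num))) ?_
    rw [norm_neg, ← coe_a₂, ← PadicInt.coe_add, ← PadicInt.coe_add]
    exact (PadicInt.norm_le_one _).trans_lt h1

/-- Two integral points which are `p`-adically closer than the gradient at the first one have a
difference in the kernel of reduction. -/
lemma sub_mem_filtration_one {x₁ x₂ y₁ y₂ : ℤ_[p]}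
    (h₁ : W.toAffine.Nonsingular (x₁ : ℚ_[p]) (y₁ : ℚ_[p]))
    (h₂ : W.toAffine.Nonsingular (x₂ : ℚ_[p]) (y₂ : ℚ_[p])) {δ : ℝ}
    (hx : ‖(x₁ : ℚ_[p]) - x₂‖ < δ) (hy : ‖(y₁ : ℚ_[p]) - y₂‖ < δ)
    (hδ : δ ≤ ‖W.a₁ * y₁ - (3 * (x₁ : ℚ_[p]) ^ 2 + 2 * W.a₂ * x₁ + W.a₄)‖ ∨
      δ ≤ ‖2 * (y₁ : ℚ_[p]) + W.a₁ * x₁ + W.a₃‖) :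
    Affine.Point.some _ _ h₁ - .some _ _ h₂ ∈ filtration p W 1 := by
  rw [sub_eq_add_neg, Affine.Point.neg_some]
  by_cases hxy : (x₁ : ℚ_[p]) = x₂ ∧
      (y₁ : ℚ_[p]) = W.toAffine.negY (x₂ : ℚ_[p]) (W.toAffine.negY (x₂ : ℚ_[p]) y₂)
  · rw [Affine.Point.add_of_Y_eq hxy.1 hxy.2]
    exact zero_mem_filtration 1
  · rw [Affine.Point.add_some hxy, some_mem_filtration_one_iff]
    have h₂' := (Affine.equation_neg _ _).mpr h₂.1
    rw [coe_negY] at hxy h₂' ⊢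
    refine one_lt_norm_addX _ _ (one_lt_norm_slope h₁.1 h₂' hxy hx ?_ hδ)
    rwa [← coe_negY, Affine.negY_negY]

lemma sub_mem_filtration_one_of_toZMod_eq {x₁ x₂ y₁ y₂ : ℤ_[p]}
    (h₁ : W.toAffine.Nonsingular (x₁ : ℚ_[p]) (y₁ : ℚ_[p]))
    (h₂ : W.toAffine.Nonsingular (x₂ : ℚ_[p]) (y₂ : ℚ_[p]))
    (hx : PadicInt.toZMod x₁ = PadicInt.toZMod x₂) (hy : PadicInt.toZMod y₁ = PadicInt.toZMod y₂)
    (hn : (reductionMod p W).toAffine.Nonsingular (PadicInt.toZMod x₁) (PadicInt.toZMod y₁)) :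
    Affine.Point.some _ _ h₁ - .some _ _ h₂ ∈ filtration p W 1 :=
  sub_mem_filtration_one h₁ h₂ ((toZMod_eq_iff _ _).mp hx) ((toZMod_eq_iff _ _).mp hy)
    ((nonsingular_reductionMod_iff h₁.1).mp hn)

/-- If the reductions differed, the addition formulas would give the difference integral
coordinates. -/
lemma toZMod_eq_of_sub_mem_filtration_one {x₁ x₂ y₁ y₂ : ℤ_[p]}
    {h₁ : W.toAffine.Nonsingular (x₁ : ℚ_[p]) (y₁ : ℚ_[p])}
    {h₂ : W.toAffine.Nonsingular (x₂ : ℚ_[p]) (y₂ : ℚ_[p])}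
    (h : Affine.Point.some _ _ h₁ - .some _ _ h₂ ∈ filtration p W 1) :
    PadicInt.toZMod x₁ = PadicInt.toZMod x₂ ∧ PadicInt.toZMod y₁ = PadicInt.toZMod y₂ := by
  by_contra hne
  rw [sub_eq_add_neg, Affine.Point.neg_some] at h
  have h₂' := (Affine.nonsingular_neg _ _).mpr h₂
  simp only [coe_negY] at h h₂'
  obtain ⟨x₃, y₃, h₃, he, -⟩ := exists_add_eq h₁ h₂' (by
    rwa [reductionMod, Affine.map_negY, Affine.negY_negY])
  rw [he] at h
  exact some_coe_notMem_filtration_one _ _ h₃ h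

/-- The case of two points in the kernel of reduction is excluded here: it needs the rescaling
argument of `add_mem_filtration`. -/
lemma add_mem_filtration_zero {P Q : W.toAffine.Point} (hP : P ∈ filtration p W 0)
    (hP1 : P ∉ filtration p W 1) (hQ : Q ∈ filtration p W 0) : P + Q ∈ filtration p W 0 := by
  obtain ⟨x₁, y₁, h₁, rfl⟩ := (mem_filtration_one_or_exists P).resolve_left hP1
  have n₁ := (some_coe_mem_filtration_zero_iff _ _ _).mp hP
  rcases mem_filtration_one_or_exists Q with hQ1 | ⟨x₂, y₂, h₂, rfl⟩
  -- If the sum `R` is integral, `R - P = Q` lies in the kernel, so `R` has the same reduction as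
  -- `P`.
  · rcases mem_filtration_one_or_exists (.some _ _ h₁ + Q) with hR1 | ⟨x₃, y₃, h₃, hR⟩
    · exact filtration_antitone zero_le_one hR1
    · rw [hR]
      have hQ' : Affine.Point.some _ _ h₃ - .some _ _ h₁ ∈ filtration p W 1 := by
        rwa [← hR, add_sub_cancel_left]
      obtain ⟨ex, ey⟩ := toZMod_eq_of_sub_mem_filtration_one hQ'
      rwa [some_coe_mem_filtration_zero_iff, ex, ey]
  · by_cases hxy : PadicInt.toZMod x₁ = PadicInt.toZMod x₂ ∧ PadicInt.toZMod y₁ =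
      (reductionMod p W).toAffine.negY (PadicInt.toZMod x₂) (PadicInt.toZMod y₂)
    · refine filtration_antitone zero_le_one ?_
      have h₂' := (Affine.nonsingular_neg _ _).mpr h₂
      have e : Affine.Point.some _ _ h₂ = -.some _ _ h₂' := by
        rw [← Affine.Point.neg_some, neg_neg]
      rw [e, ← sub_eq_add_neg]
      simp only [coe_negY] at h₂' ⊢
      refine sub_mem_filtration_one_of_toZMod_eq h₁ h₂' hxy.1 ?_ n₁
      rw [← Affine.map_negY]
      exact hxy.2
    · obtain ⟨x₃, y₃, h₃, he, hn⟩ := exists_add_eq h₁ h₂ hxy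
      rw [he, some_coe_mem_filtration_zero_iff]
      exact hn n₁ ((some_coe_mem_filtration_zero_iff _ _ _).mp hQ)

end Integral

end PadicFiltration

/-! ### The cuspidal cubic, and the discriminant as a combination of partial derivatives -/

namespace WeierstrassCurve

/-- The cuspidal curve `Y² = X³`. -/
def cusp (k : Type*) [Field k] : WeierstrassCurve k := ⟨0, 0, 0, 0, 0⟩

section Cusp

variable {k : Type*} [Field k]

lemma cusp_nonsingular_iff (x y : k) :
    (cusp k).toAffine.Nonsingular x y ↔ (cusp k).toAffine.Equation x y ∧ x ≠ 0 := by
  rw [Affine.nonsingular_iff']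
  refine and_congr_right fun h ↦ ?_
  rw [Affine.equation_iff'] at h
  simp only [cusp, zero_mul, mul_zero, add_zero, zero_sub, ne_eq, neg_eq_zero, mul_eq_zero,
    sub_eq_zero, pow_eq_zero_iff two_ne_zero] at h ⊢
  constructor
  · rintro h' rfl
    have : y = 0 := by simpa using h
    simp [this] at h'
  · intro hx
    have hy : y ≠ 0 := by
      rintro rfl
      exact hx ((pow_eq_zero_iff three_ne_zero).mp (by simpa using h.symm))
    -- The gradient is `(-3x², 2y)`. One entry may vanish identically in characteristic 2 or 3, but
    -- `3 - 2 = 1` prevents both.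
    by_contra! hc
    have h2 : (2 : k) = 0 := hc.2.resolve_right hy
    have h3 : (3 : k) = 0 := hc.1.resolve_right hx
    exact one_ne_zero (α := k) (by linear_combination h3 - h2)

lemma natCard_point_cusp : Nat.card (cusp k).toAffine.Point = Nat.card k := by
  classical
  have hns (t : k) (ht : t ≠ 0) : (cusp k).toAffine.Nonsingular (t ^ 2) (t ^ 3) := by
    rw [cusp_nonsingular_iff, Affine.equation_iff']
    refine ⟨?_, pow_ne_zero 2 ht⟩
    simp only [cusp]
    ring
  let f : k → (cusp k).toAffine.Point := fun t ↦
    -- The parameter `t = 0` would give the cusp itself; the point at infinity takes its place. Only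
    -- a bijection is needed, not a homomorphism.
    if ht : t = 0 then .zero else .some (t ^ 2) (t ^ 3) (hns t ht)
  refine (Nat.card_congr (Equiv.ofBijective f ⟨fun t u htu ↦ ?_, ?_⟩)).symm
  · by_cases ht : t = 0 <;> by_cases hu : u = 0
    · rw [ht, hu]
    · simp [f, ht, hu] at htu
    · simp [f, ht, hu] at htu
    · simp only [f, dif_neg ht, dif_neg hu, Affine.Point.some.injEq] at htu
      have h : t ^ 2 * t = t ^ 2 * u := by
        calc t ^ 2 * t = t ^ 3 := by ring
          _ = u ^ 2 * u := by rw [htu.2]; ring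
          _ = t ^ 2 * u := by rw [htu.1]
      exact mul_left_cancel₀ (pow_ne_zero 2 ht) h
  · rintro (_ | ⟨x, y, h⟩)
    · exact ⟨0, dif_pos rfl⟩
    · obtain ⟨he, hx⟩ := (cusp_nonsingular_iff x y).mp h
      rw [Affine.equation_iff'] at he
      simp only [cusp, zero_mul, add_zero, sub_eq_zero] at he
      have hy : y ≠ 0 := by
        rintro rfl
        exact hx ((pow_eq_zero_iff three_ne_zero).mp (by simpa using he.symm))
      refine ⟨y / x, ?_⟩
      simp only [f, dif_neg (div_ne_zero hy hx), Affine.Point.some.injEq]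
      constructor <;> field_simp <;> exact he

end Cusp

/-- The discriminant lies in the ideal generated by the equation and its partial derivatives. -/
lemma exists_Δ_eq {R : Type*} [CommRing R] (W : WeierstrassCurve R) {x y : R}
    (h : W.toAffine.Equation x y) : ∃ c d : R,
      W.Δ = c * (W.a₁ * y - (3 * x ^ 2 + 2 * W.a₂ * x + W.a₄)) + d * (2 * y + W.a₁ * x + W.a₃) := by
  have key (W : WeierstrassCurve R) (h6 : W.a₆ = 0) : W.Δ =
      (16 * W.b₄ ^ 2 - W.b₂ ^ 2 * W.a₄) * -W.a₄ + (-W.b₂ ^ 2 * (-W.a₁ * W.a₄ + W.a₂ * W.a₃)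
        - 8 * W.b₄ ^ 2 * W.a₁ - 27 * W.b₆ * W.a₃ + 9 * W.b₂ * W.b₄ * W.a₃) * W.a₃ := by
    rw [Δ, b₂, b₄, b₆, b₈, h6]
    ring
  -- Translating `(x, y)` to the origin makes `a₆ = 0`, keeps `Δ`, and turns `-a₄` and `a₃` into the
  -- two partial derivatives.
  set V := VariableChange.mk 1 x 0 y • W with hV
  have h6 : V.a₆ = 0 := by
    rw [Affine.equation_iff'] at h
    rw [hV, variableChange_a₆]
    simp only [inv_one, Units.val_one]
    linear_combination -h
  have h3 : V.a₃ = 2 * y + W.a₁ * x + W.a₃ := by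
    rw [hV, variableChange_a₃]
    simp only [inv_one, Units.val_one]
    ring
  have h4 : -V.a₄ = W.a₁ * y - (3 * x ^ 2 + 2 * W.a₂ * x + W.a₄) := by
    rw [hV, variableChange_a₄]
    simp only [inv_one, Units.val_one]
    ring
  have hΔ : V.Δ = W.Δ := by
    rw [hV, variableChange_Δ]
    simp
  exact ⟨_, _, by rw [← hΔ, key V h6, ← h3, ← h4]⟩

end WeierstrassCurve

/-! ### The shift of the filtration under a change of coordinates -/

namespace PadicFiltration

open WeierstrassCurve Polynomial

variable {p : ℕ} [Fact p.Prime]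

section VariableChange

variable {E E' : WeierstrassCurve ℚ_[p]} [WeierstrassCurve.IsIntegral ℤ_[p] E]
  [WeierstrassCurve.IsIntegral ℤ_[p] E'] {C : VariableChange ℚ_[p]}

/-- If `E` is obtained from the integral equation `E'` by a change of coordinates which multiplies
it by a non-unit, then the reduction of `E` is a translate of the cuspidal curve. -/
lemma smul_reductionMod_eq_cusp (h : C • E = E') (hu : ‖(C.u : ℚ_[p])‖ < 1) {r s t : ℤ_[p]}
    (hr : (r : ℚ_[p]) = C.r) (hs : (s : ℚ_[p]) = C.s) (ht : (t : ℚ_[p]) = C.t) :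
    (VariableChange.mk 1 (PadicInt.toZMod r) (PadicInt.toZMod s) (PadicInt.toZMod t)) •
      reductionMod p E = cusp (ZMod p) := by
  have hpow {n : ℕ} (hn : n ≠ 0) {a : ℚ_[p]} (ha : ‖a‖ ≤ 1) : ‖(C.u : ℚ_[p]) ^ n * a‖ < 1 := by
    rw [mul_comm]
    refine norm_mul_lt ha ?_
    rw [norm_pow]
    exact pow_lt_one₀ (norm_nonneg _) hu hn
  set V := integralModel ℤ_[p] E with hV
  have e₁ : PadicInt.toZMod (V.a₁ + 2 * s) = 0 := by
    rw [toZMod_eq_zero_iff]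
    push_cast
    rw [coe_two, hV, coe_a₁, hs, a₁_of_smul_eq h, sub_add_cancel, ← pow_one (C.u : ℚ_[p])]
    exact hpow one_ne_zero (norm_a₁_le E')
  have e₂ : PadicInt.toZMod (V.a₂ - s * V.a₁ + 3 * r - s ^ 2) = 0 := by
    rw [toZMod_eq_zero_iff]
    push_cast
    rw [coe_three, hV, coe_a₁, coe_a₂, hr, hs]
    convert hpow two_ne_zero (norm_a₂_le E') using 2
    rw [a₂_of_smul_eq h]
    ring
  have e₃ : PadicInt.toZMod (V.a₃ + r * V.a₁ + 2 * t) = 0 := by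
    rw [toZMod_eq_zero_iff]
    push_cast
    rw [coe_two, hV, coe_a₁, coe_a₃, hr, ht]
    convert hpow three_ne_zero (norm_a₃_le E') using 2
    rw [a₃_of_smul_eq h]
    ring
  have e₄ : PadicInt.toZMod (V.a₄ - s * V.a₃ + 2 * r * V.a₂ - (t + r * s) * V.a₁ + 3 * r ^ 2
      - 2 * s * t) = 0 := by
    rw [toZMod_eq_zero_iff]
    push_cast
    rw [coe_two, coe_three, hV, coe_a₁, coe_a₂, coe_a₃, coe_a₄, hr, hs, ht]
    convert hpow four_ne_zero (norm_a₄_le E') using 2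
    rw [a₄_of_smul_eq h]
    ring
  have e₆ : PadicInt.toZMod (V.a₆ + r * V.a₄ + r ^ 2 * V.a₂ + r ^ 3 - t * V.a₃ - t ^ 2
      - r * t * V.a₁) = 0 := by
    rw [toZMod_eq_zero_iff]
    push_cast
    rw [hV, coe_a₁, coe_a₂, coe_a₃, coe_a₄, coe_a₆, hr, ht]
    convert hpow (n := 6) (by norm_num) (norm_a₆_le E') using 2
    rw [a₆_of_smul_eq h]
    ring
  simp only [map_add, map_sub, map_mul, map_pow, toZMod_two, toZMod_three] at e₁ e₂ e₃ e₄ e₆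
  rw [variableChange_def, cusp]
  ext
  · simpa [reductionMod] using e₁
  · simpa [reductionMod] using e₂
  · simpa [reductionMod] using e₃
  · simpa [reductionMod] using e₄
  · simpa [reductionMod] using e₆

variable [DecidableEq ℚ_[p]]

/-- A change of coordinates with `v(u) = k ≥ 1` shifts the filtration by `k`. -/
lemma pointEquivOfSMulEq_mem_filtration_iff (h : C • E = E') {k : ℕ} (hk : 1 ≤ k)
    (hu : ‖(C.u : ℚ_[p])‖ = ((p : ℝ) ^ k)⁻¹) (hr : ‖C.r‖ ≤ 1) (hs : ‖C.s‖ ≤ 1) (ht : ‖C.t‖ ≤ 1)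
    (n : ℕ) (P : E'.toAffine.Point) :
    pointEquivOfSMulEq h P ∈ filtration p E n ↔ P ∈ filtration p E' (n + k) := by
  rcases P with _ | ⟨x, y, hxy⟩
  · exact iff_of_true (zero_mem_filtration n) (zero_mem_filtration (n + k))
  have hp : (1 : ℝ) < p := mod_cast (Fact.out : p.Prime).one_lt
  have hux : ‖(C.u : ℚ_[p]) ^ 2 * x‖ = ((p : ℝ) ^ (2 * k))⁻¹ * ‖x‖ := by
    rw [norm_mul, norm_pow, hu, inv_pow, ← pow_mul, mul_comm k]
  have hrhs : .some x y hxy ∈ filtration p E' (n + k) ↔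
      (p : ℝ) ^ (2 * n) ≤ ‖(C.u : ℚ_[p]) ^ 2 * x‖ := by
    rw [some_mem_filtration_iff (by omega), hux, le_inv_mul_iff₀ (by positivity), ← pow_add,
      ← mul_add, add_comm k]
  rw [hrhs, pointEquivOfSMulEq_some]
  have hnorm {c : ℝ} (hc : 1 < c) : c ≤ ‖C.mapX x‖ ↔ c ≤ ‖(C.u : ℚ_[p]) ^ 2 * x‖ := by
    rw [VariableChange.mapX]
    refine ⟨fun h ↦ ?_, fun h ↦ ?_⟩
    · by_contra! hlt
      exact absurd h (not_le.mpr (norm_add_lt hlt (hr.trans_lt hc)))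
    · rwa [norm_add_eq_left (hr.trans_lt (hc.trans_le h))]
  rcases n.eq_zero_or_pos with rfl | hn
  swap
  · rw [some_mem_filtration_iff hn, hnorm (one_lt_pow₀ hp (by omega))]
  rw [mul_zero, pow_zero]
  -- For `n = 0`: if `|u²x| > 1` the image reduces to infinity. Otherwise `(u²x, u³y)` is integral
  -- and reduces to a point of the cusp, nonsingular exactly when `u²x` is a unit.
  rcases lt_or_ge 1 ‖(C.u : ℚ_[p]) ^ 2 * x‖ with h1 | h1
  · exact iff_of_true (.inl (h1.trans_le ((hnorm h1).mpr le_rfl))) h1.le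
  have hX : ‖C.mapX x‖ ≤ 1 := norm_add_le' h1 hr
  have hns := (nonsingular_of_smul_eq h x y).mpr hxy
  have hY := norm_Y_le_one hns.1 hX
  have hy : ‖(C.u : ℚ_[p]) ^ 3 * y‖ ≤ 1 := by
    have e : (C.u : ℚ_[p]) ^ 3 * y = C.mapY x y + (-(C.s * ((C.u : ℚ_[p]) ^ 2 * x)) + -C.t) := by
      rw [VariableChange.mapY]
      ring
    rw [e]
    refine norm_add_le' hY (norm_add_le' ?_ (by rwa [norm_neg]))
    rw [norm_neg, norm_mul]
    exact mul_le_one₀ hs (norm_nonneg _) h1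
  obtain ⟨r, hr⟩ : ∃ a : ℤ_[p], (a : ℚ_[p]) = C.r := ⟨⟨_, hr⟩, rfl⟩
  obtain ⟨s, hs⟩ : ∃ a : ℤ_[p], (a : ℚ_[p]) = C.s := ⟨⟨_, hs⟩, rfl⟩
  obtain ⟨t, ht⟩ : ∃ a : ℤ_[p], (a : ℚ_[p]) = C.t := ⟨⟨_, ht⟩, rfl⟩
  obtain ⟨a, ha⟩ : ∃ a : ℤ_[p], (a : ℚ_[p]) = (C.u : ℚ_[p]) ^ 2 * x := ⟨⟨_, h1⟩, rfl⟩
  obtain ⟨b, hb⟩ : ∃ a : ℤ_[p], (a : ℚ_[p]) = (C.u : ℚ_[p]) ^ 3 * y := ⟨⟨_, hy⟩, rfl⟩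
  have hX' : C.mapX x = ((a + r : ℤ_[p]) : ℚ_[p]) := by
    rw [VariableChange.mapX, PadicInt.coe_add, ha, hr]
  have hY' : C.mapY x y = ((b + s * a + t : ℤ_[p]) : ℚ_[p]) := by
    rw [VariableChange.mapY]
    push_cast
    rw [ha, hb, hs, ht]
    ring
  have hu1 : ‖(C.u : ℚ_[p])‖ < 1 := by
    rw [hu]
    exact inv_lt_one_of_one_lt₀ (one_lt_pow₀ hp (by omega))
  have hcusp := smul_reductionMod_eq_cusp h hu1 hr hs ht
  simp only [hX', hY'] at hns ⊢
  have heq := equation_reductionMod hns.1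
  have e₁ : PadicInt.toZMod (a + r) = (VariableChange.mk 1 (PadicInt.toZMod r) (PadicInt.toZMod s)
      (PadicInt.toZMod t)).mapX (PadicInt.toZMod a) := by
    simp [VariableChange.mapX]
  have e₂ : PadicInt.toZMod (b + s * a + t) = (VariableChange.mk 1 (PadicInt.toZMod r)
      (PadicInt.toZMod s) (PadicInt.toZMod t)).mapY (PadicInt.toZMod a) (PadicInt.toZMod b) := by
    simp [VariableChange.mapY]
  rw [some_coe_mem_filtration_zero_iff, e₁, e₂, nonsingular_of_smul_eq hcusp, cusp_nonsingular_iff,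
    and_iff_right, toZMod_ne_zero_iff, ha]
  rwa [e₁, e₂, equation_of_smul_eq hcusp] at heq

end VariableChange

/-! ### Rescaling, and the filtration steps as subgroups -/

section Scale

variable (W : WeierstrassCurve ℚ_[p])

/-- The equation obtained from `W` by multiplying `x` by `p²ᵐ` and `y` by `p³ᵐ`. -/
noncomputable def scale (m : ℕ) : WeierstrassCurve ℚ_[p] :=
  ⟨p ^ m * W.a₁, (p ^ m) ^ 2 * W.a₂, (p ^ m) ^ 3 * W.a₃, (p ^ m) ^ 4 * W.a₄, (p ^ m) ^ 6 * W.a₆⟩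

/-- The change of coordinates from `scale W m` to `W`. -/
noncomputable def scaleChange (p : ℕ) [Fact p.Prime] (m : ℕ) : VariableChange ℚ_[p] :=
  ⟨Units.mk0 ((p : ℚ_[p]) ^ m)
    (pow_ne_zero m (Nat.cast_ne_zero.mpr (Fact.out : p.Prime).ne_zero)), 0, 0, 0⟩

instance [WeierstrassCurve.IsIntegral ℤ_[p] W] (m : ℕ) :
    WeierstrassCurve.IsIntegral ℤ_[p] (scale W m) := by
  apply isIntegral_of_exists_lift ℤ_[p]
  · exact ⟨p ^ m * (integralModel ℤ_[p] W).a₁, by simp [scale, coe_a₁]⟩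
  · exact ⟨(p ^ m) ^ 2 * (integralModel ℤ_[p] W).a₂, by simp [scale, coe_a₂]⟩
  · exact ⟨(p ^ m) ^ 3 * (integralModel ℤ_[p] W).a₃, by simp [scale, coe_a₃]⟩
  · exact ⟨(p ^ m) ^ 4 * (integralModel ℤ_[p] W).a₄, by simp [scale, coe_a₄]⟩
  · exact ⟨(p ^ m) ^ 6 * (integralModel ℤ_[p] W).a₆, by simp [scale, coe_a₆]⟩

lemma scaleChange_smul_scale (m : ℕ) : scaleChange p m • scale W m = W := by
  have hp : (p : ℚ_[p]) ≠ 0 := Nat.cast_ne_zero.mpr (Fact.out : p.Prime).ne_zero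
  rw [variableChange_def]
  ext <;> simp [scaleChange, scale, hp]

lemma norm_scaleChange_u (m : ℕ) : ‖((scaleChange p m).u : ℚ_[p])‖ = ((p : ℝ) ^ m)⁻¹ := by
  simp [scaleChange]

variable [DecidableEq ℚ_[p]] [WeierstrassCurve.IsIntegral ℤ_[p] W]

/-- This turns questions about the step `m` of `W` into questions about the step `0` of another
integral equation. -/
lemma scale_mem_filtration_iff {m : ℕ} (hm : 1 ≤ m) (n : ℕ) (P : W.toAffine.Point) :
    pointEquivOfSMulEq (scaleChange_smul_scale W m) P ∈ filtration p (scale W m) n ↔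
      P ∈ filtration p W (n + m) :=
  pointEquivOfSMulEq_mem_filtration_iff _ hm (norm_scaleChange_u m) (by simp [scaleChange])
    (by simp [scaleChange]) (by simp [scaleChange]) n P

variable {W}

lemma add_mem_filtration_of_notMem {m : ℕ} (hm : 1 ≤ m) {P Q : W.toAffine.Point}
    (hP : P ∈ filtration p W m) (hP' : P ∉ filtration p W (m + 1)) (hQ : Q ∈ filtration p W m) :
    P + Q ∈ filtration p W m := by
  rw [← zero_add m, ← scale_mem_filtration_iff W hm] at hP hQ ⊢
  rw [add_comm m, ← scale_mem_filtration_iff W hm] at hP'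
  rw [map_add]
  exact add_mem_filtration_zero hP hP' hQ

omit [DecidableEq ℚ_[p]] in
lemma exists_mem_filtration_notMem {n : ℕ} (hn : 1 ≤ n) {P : W.toAffine.Point}
    (hP : P ∈ filtration p W n) (h0 : P ≠ 0) :
    ∃ m, n ≤ m ∧ P ∈ filtration p W m ∧ P ∉ filtration p W (m + 1) := by
  have hp : (1 : ℝ) < p := mod_cast (Fact.out : p.Prime).one_lt
  rcases P with _ | ⟨x, y, h⟩
  · exact absurd rfl h0
  obtain ⟨m, hm, hx⟩ := exists_norm_X_eq h.1
    ((some_mem_filtration_one_iff h).mp (filtration_antitone hn hP))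
  rw [some_mem_filtration_iff hn, hx, pow_le_pow_iff_right₀ hp] at hP
  refine ⟨m, by omega, ?_, ?_⟩
  · rw [some_mem_filtration_iff hm, hx]
  · rw [some_mem_filtration_iff (by omega), hx, pow_le_pow_iff_right₀ hp]
    omega

lemma add_mem_filtration {n : ℕ} {P Q : W.toAffine.Point} (hP : P ∈ filtration p W n)
    (hQ : Q ∈ filtration p W n) : P + Q ∈ filtration p W n := by
  have key {n : ℕ} (hn : 1 ≤ n) {P Q : W.toAffine.Point} (hP : P ∈ filtration p W n)
      (hQ : Q ∈ filtration p W n) : P + Q ∈ filtration p W n := by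
    by_cases hP0 : P = 0
    · rwa [hP0, zero_add]
    by_cases hQ0 : Q = 0
    · rwa [hQ0, add_zero]
    obtain ⟨k, hk, hPk, hPk'⟩ := exists_mem_filtration_notMem hn hP hP0
    obtain ⟨l, hl, hQl, hQl'⟩ := exists_mem_filtration_notMem hn hQ hQ0
    -- The point with the smaller exact level is outside the next step, as
    -- `add_mem_filtration_of_notMem` requires of one summand.
    rcases le_total k l with hkl | hkl
    · exact filtration_antitone hk (add_mem_filtration_of_notMem (hn.trans hk) hPk hPk'
        (filtration_antitone hkl hQl))
    · rw [add_comm]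
      exact filtration_antitone hl (add_mem_filtration_of_notMem (hn.trans hl) hQl hQl'
        (filtration_antitone hkl hPk))
  rcases n.eq_zero_or_pos with rfl | hn
  swap
  · exact key hn hP hQ
  by_cases hP1 : P ∈ filtration p W 1
  · by_cases hQ1 : Q ∈ filtration p W 1
    · exact filtration_antitone zero_le_one (key le_rfl hP1 hQ1)
    · rw [add_comm]
      exact add_mem_filtration_zero hQ hQ1 hP
  · exact add_mem_filtration_zero hP hP1 hQ

variable (W) in
/-- The `n`-th step of the filtration as a subgroup. -/
def filtrationSubgroup (n : ℕ) : AddSubgroup W.toAffine.Point where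
  carrier := filtration p W n
  zero_mem' := zero_mem_filtration n
  add_mem' := add_mem_filtration
  neg_mem' := neg_mem_filtration

lemma mem_filtrationSubgroup {n : ℕ} {P : W.toAffine.Point} :
    P ∈ filtrationSubgroup W n ↔ P ∈ filtration p W n :=
  Iff.rfl

end Scale

end PadicFiltration

/-- Since `f` is only a map of sets, reduction modulo `p` never has to be shown to be a
homomorphism. -/
lemma AddSubgroup.index_eq_natCard_of_surjective {G X : Type*} [AddCommGroup G] (H : AddSubgroup G)
    (f : G → X) (hf : Function.Surjective f) (h : ∀ a b, f a = f b ↔ a - b ∈ H) :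
    H.index = Nat.card X := by
  have hmk (a b : G) : (a : G ⧸ H) = b ↔ f a = f b := by
    rw [eq_comm, QuotientAddGroup.eq, h, sub_eq_neg_add]
  refine Nat.card_congr (Equiv.ofBijective (fun q : G ⧸ H ↦ f q.out) ⟨fun q r hqr ↦ ?_, fun x ↦ ?_⟩)
  · rw [← QuotientAddGroup.out_eq' q, ← QuotientAddGroup.out_eq' r]
    exact (hmk _ _).mpr hqr
  · obtain ⟨a, rfl⟩ := hf x
    exact ⟨a, (hmk _ _).mp (QuotientAddGroup.out_eq' _)⟩

/-! ### Hensel lifting and the indices of the filtration -/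

namespace PadicFiltration

open WeierstrassCurve Polynomial

variable {p : ℕ} [Fact p.Prime]

lemma exists_eval_eq_zero (F : ℤ_[p][X]) (a : ℤ_[p]) (h0 : PadicInt.toZMod (F.eval a) = 0)
    (h1 : PadicInt.toZMod (F.derivative.eval a) ≠ 0) :
    ∃ z : ℤ_[p], F.eval z = 0 ∧ PadicInt.toZMod z = PadicInt.toZMod a := by
  rw [toZMod_eq_zero_iff, ← PadicInt.norm_def] at h0
  rw [toZMod_ne_zero_iff, ← PadicInt.norm_def] at h1
  have h1 : ‖F.derivative.eval a‖ = 1 := le_antisymm (PadicInt.norm_le_one _) h1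
  obtain ⟨z, hz, hza, -⟩ := hensels_lemma (F := F) (a := a) (by
    rwa [coe_aeval_eq_eval, h1, one_pow])
  rw [coe_aeval_eq_eval] at hz hza
  refine ⟨z, hz, ?_⟩
  rw [toZMod_eq_iff, ← PadicInt.coe_sub, ← PadicInt.norm_def]
  rwa [h1] at hza

section

variable (W : WeierstrassCurve ℚ_[p]) [WeierstrassCurve.IsIntegral ℤ_[p] W]

/-- Some partial derivative is nonzero modulo `p`: an arbitrary lift of the other coordinate is
fixed, and Hensel's lemma lifts this one. -/
lemma exists_equation_of_nonsingular_reductionMod {x y : ZMod p}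
    (h : (reductionMod p W).toAffine.Nonsingular x y) : ∃ a b : ℤ_[p],
      PadicInt.toZMod a = x ∧ PadicInt.toZMod b = y ∧
        W.toAffine.Equation (a : ℚ_[p]) (b : ℚ_[p]) := by
  obtain ⟨a, rfl⟩ := toZMod_surjective x
  obtain ⟨b, rfl⟩ := toZMod_surjective y
  set V := integralModel ℤ_[p] W with hV
  simp only [← equation_integralModel, ← hV]
  rw [Affine.nonsingular_iff', Affine.equation_iff'] at h
  simp only [reductionMod, ← hV, map_a₁, map_a₂, map_a₃, map_a₄, map_a₆] at h
  obtain ⟨h, hX | hY⟩ := h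
  · obtain ⟨c, hc⟩ : ∃ c, c = b ^ 2 + V.a₃ * b - V.a₆ := ⟨_, rfl⟩
    obtain ⟨d, hd⟩ : ∃ d, d = V.a₁ * b - V.a₄ := ⟨_, rfl⟩
    have hc' := congrArg PadicInt.toZMod hc
    have hd' := congrArg PadicInt.toZMod hd
    simp only [map_add, map_sub, map_mul, map_pow] at hc' hd'
    obtain ⟨z, hz, hza⟩ := exists_eval_eq_zero (C c + C d * X - C V.a₂ * X ^ 2 - X ^ 3) a
      (by
        simp only [eval_sub, eval_add, eval_mul, eval_C, eval_X, eval_pow, map_sub, map_add,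
          map_mul, map_pow]
        linear_combination h + hc' + PadicInt.toZMod a * hd')
      (by
        intro h'
        refine hX ?_
        simp [toZMod_two] at h'
        linear_combination h' - hd')
    refine ⟨z, b, hza, rfl, ?_⟩
    rw [Affine.equation_iff']
    simp only [eval_sub, eval_add, eval_mul, eval_C, eval_X, eval_pow] at hz
    linear_combination hz - hc - z * hd
  · obtain ⟨c, hc⟩ : ∃ c, c = a ^ 3 + V.a₂ * a ^ 2 + V.a₄ * a + V.a₆ := ⟨_, rfl⟩
    obtain ⟨d, hd⟩ : ∃ d, d = V.a₁ * a + V.a₃ := ⟨_, rfl⟩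
    have hc' := congrArg PadicInt.toZMod hc
    have hd' := congrArg PadicInt.toZMod hd
    simp only [map_add, map_mul, map_pow] at hc' hd'
    obtain ⟨z, hz, hza⟩ := exists_eval_eq_zero (X ^ 2 + C d * X - C c) b
      (by
        simp only [eval_sub, eval_add, eval_mul, eval_C, eval_X, eval_pow, map_sub, map_add,
          map_mul, map_pow]
        linear_combination h - hc' + PadicInt.toZMod b * hd')
      (by
        intro h'
        refine hY ?_
        simp at h'
        linear_combination h' - hd')
    refine ⟨a, z, rfl, hza, ?_⟩
    rw [Affine.equation_iff']
    simp only [eval_sub, eval_add, eval_mul, eval_C, eval_X, eval_pow] at hz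
    linear_combination hz + hc - z * hd

open Classical in
/-- The reduction of a point modulo `p`, with the value `0` for a point with singular reduction. -/
noncomputable def reducePoint : W.toAffine.Point → (reductionMod p W).toAffine.Point
  | .zero => .zero
  | .some x y _ => if h : ∃ a b : ℤ_[p], (a : ℚ_[p]) = x ∧ (b : ℚ_[p]) = y ∧
      (reductionMod p W).toAffine.Nonsingular (PadicInt.toZMod a) (PadicInt.toZMod b) then
        .some _ _ h.choose_spec.choose_spec.2.2 else .zero

variable {W}

lemma reducePoint_of_mem {P : W.toAffine.Point} (hP : P ∈ filtration p W 1) :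
    reducePoint W P = 0 := by
  rcases P with _ | ⟨x, y, h⟩
  · rfl
  · rw [some_mem_filtration_one_iff] at hP
    refine dif_neg ?_
    rintro ⟨a, -, rfl, -⟩
    exact hP.not_ge a.2

lemma reducePoint_coe {a b : ℤ_[p]} (h : W.toAffine.Nonsingular (a : ℚ_[p]) (b : ℚ_[p]))
    (h' : (reductionMod p W).toAffine.Nonsingular (PadicInt.toZMod a) (PadicInt.toZMod b)) :
    reducePoint W (.some _ _ h) = .some _ _ h' := by
  have hex : ∃ a' b' : ℤ_[p], (a' : ℚ_[p]) = a ∧ (b' : ℚ_[p]) = b ∧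
      (reductionMod p W).toAffine.Nonsingular (PadicInt.toZMod a') (PadicInt.toZMod b') :=
    ⟨a, b, rfl, rfl, h'⟩
  refine (dif_pos hex).trans ?_
  have ea : hex.choose = a := PadicInt.ext hex.choose_spec.choose_spec.1
  have eb : hex.choose_spec.choose = b := PadicInt.ext hex.choose_spec.choose_spec.2.1
  rw [Affine.Point.some.injEq]
  exact ⟨congrArg _ ea, congrArg _ eb⟩

variable [DecidableEq ℚ_[p]]

lemma reducePoint_eq_iff {P Q : W.toAffine.Point} (hP : P ∈ filtrationSubgroup W 0)
    (hQ : Q ∈ filtrationSubgroup W 0) :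
    reducePoint W P = reducePoint W Q ↔ P - Q ∈ filtrationSubgroup W 1 := by
  have key {P Q : W.toAffine.Point} (hP : P ∈ filtrationSubgroup W 1)
      (hQ : Q ∈ filtrationSubgroup W 0) :
      reducePoint W P = reducePoint W Q ↔ P - Q ∈ filtrationSubgroup W 1 := by
    rw [sub_eq_add_neg, add_mem_cancel_left hP, neg_mem_iff, reducePoint_of_mem hP,
      mem_filtrationSubgroup]
    rcases mem_filtration_one_or_exists Q with hQ1 | ⟨x, y, h, rfl⟩
    · exact iff_of_true (reducePoint_of_mem hQ1).symm hQ1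
    · refine iff_of_false ?_ (some_coe_notMem_filtration_one x y h)
      rw [reducePoint_coe h ((some_coe_mem_filtration_zero_iff x y h).mp hQ)]
      exact (Affine.Point.some_ne_zero _).symm
  rcases mem_filtration_one_or_exists P with hP1 | ⟨x₁, y₁, h₁, rfl⟩
  · exact key hP1 hQ
  rcases mem_filtration_one_or_exists Q with hQ1 | ⟨x₂, y₂, h₂, rfl⟩
  · rw [eq_comm, key hQ1 hP, ← neg_mem_iff, neg_sub]
  have n₁ := (some_coe_mem_filtration_zero_iff x₁ y₁ h₁).mp hP
  have n₂ := (some_coe_mem_filtration_zero_iff x₂ y₂ h₂).mp hQ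
  rw [reducePoint_coe h₁ n₁, reducePoint_coe h₂ n₂, Affine.Point.some.injEq]
  exact ⟨fun h ↦ sub_mem_filtration_one_of_toZMod_eq h₁ h₂ h.1 h.2 n₁,
    toZMod_eq_of_sub_mem_filtration_one⟩

variable (W) in
/-- The reduction modulo `p` identifies `W⁰ / W¹` with the nonsingular points of the reduction. -/
lemma relIndex_filtrationSubgroup_one_zero (hΔ : W.Δ ≠ 0) :
    (filtrationSubgroup W 1).relIndex (filtrationSubgroup W 0) = numNonsingular p W := by
  refine AddSubgroup.index_eq_natCard_of_surjective _ (fun P ↦ reducePoint W P.1) ?_ ?_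
  · rintro (_ | ⟨x, y, h⟩)
    · exact ⟨0, rfl⟩
    · obtain ⟨a, b, rfl, rfl, hab⟩ := exists_equation_of_nonsingular_reductionMod W h
      have hab := (Affine.equation_iff_nonsingular_of_Δ_ne_zero hΔ).mp hab
      exact ⟨⟨.some _ _ hab, (some_coe_mem_filtration_zero_iff a b hab).mpr h⟩,
        reducePoint_coe hab h⟩
  · rintro ⟨P, hP⟩ ⟨Q, hQ⟩
    exact reducePoint_eq_iff hP hQ

lemma filtrationSubgroup_add_eq_comap {m : ℕ} (hm : 1 ≤ m) (n : ℕ) :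
    filtrationSubgroup W (n + m) = (filtrationSubgroup (scale W m) n).comap
      (pointEquivOfSMulEq (scaleChange_smul_scale W m)).toAddMonoidHom := by
  ext P
  exact (scale_mem_filtration_iff W hm n P).symm

omit [DecidableEq ℚ_[p]] in
variable (W) in
lemma numNonsingular_scale {m : ℕ} (hm : 1 ≤ m) : numNonsingular p (scale W m) = p := by
  have hp : (1 : ℝ) < p := mod_cast (Fact.out : p.Prime).one_lt
  have hu : ‖((scaleChange p m).u : ℚ_[p])‖ < 1 := by
    rw [norm_scaleChange_u]
    exact inv_lt_one_of_one_lt₀ (one_lt_pow₀ hp (by omega))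
  have h := smul_reductionMod_eq_cusp (scaleChange_smul_scale W m) hu
    (r := 0) (s := 0) (t := 0) rfl rfl rfl
  rw [map_zero, ← VariableChange.one_def, one_smul] at h
  rw [numNonsingular, h, natCard_point_cusp, Nat.card_zmod]

/-- The quotient is step `0` modulo step `1` of `scale W n`, whose reduction is the cusp with its
`p` nonsingular points. -/
lemma relIndex_filtrationSubgroup_succ (hΔ : W.Δ ≠ 0) {n : ℕ} (hn : 1 ≤ n) :
    (filtrationSubgroup W (n + 1)).relIndex (filtrationSubgroup W n) = p := by
  have hΔ' : (scale W n).Δ ≠ 0 := by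
    intro h0
    rw [← scaleChange_smul_scale W n, variableChange_Δ, h0, mul_zero] at hΔ
    exact hΔ rfl
  have h0 := filtrationSubgroup_add_eq_comap (W := W) hn 0
  rw [zero_add] at h0
  rw [add_comm n, filtrationSubgroup_add_eq_comap hn, h0, AddSubgroup.relIndex_comap,
    AddSubgroup.map_comap_eq_self_of_surjective, relIndex_filtrationSubgroup_one_zero _ hΔ',
    numNonsingular_scale W hn]
  exact (pointEquivOfSMulEq (scaleChange_smul_scale W n)).surjective

variable (W) in
lemma index_filtrationSubgroup_succ (hΔ : W.Δ ≠ 0) (n : ℕ) :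
    (filtrationSubgroup W (n + 1)).index =
      (filtrationSubgroup W 0).index * numNonsingular p W * p ^ n := by
  have hle (n : ℕ) : filtrationSubgroup W (n + 1) ≤ filtrationSubgroup W n :=
    filtration_antitone n.le_succ
  induction n with
  | zero =>
    rw [← AddSubgroup.relIndex_mul_index (hle 0), zero_add,
      relIndex_filtrationSubgroup_one_zero W hΔ, pow_zero, mul_one, mul_comm]
  | succ n ih =>
    rw [← AddSubgroup.relIndex_mul_index (hle (n + 1)), ih,
      relIndex_filtrationSubgroup_succ hΔ (by omega), pow_succ]
    ring

-- This bounds the gradient below at every integral point, including those with singular reduction.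
omit [DecidableEq ℚ_[p]] in
lemma norm_Δ_le {a b : ℤ_[p]}
    (h : W.toAffine.Equation (a : ℚ_[p]) (b : ℚ_[p])) :
    ‖W.Δ‖ ≤ ‖W.a₁ * b - (3 * (a : ℚ_[p]) ^ 2 + 2 * W.a₂ * a + W.a₄)‖ ∨
      ‖W.Δ‖ ≤ ‖2 * (b : ℚ_[p]) + W.a₁ * a + W.a₃‖ := by
  obtain ⟨c, d, hcd⟩ := exists_Δ_eq _ ((equation_integralModel a b).mpr h)
  have hcd := congrArg (fun z : ℤ_[p] ↦ (z : ℚ_[p])) hcd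
  push_cast at hcd
  rw [← PadicInt.algebraMap_apply, integralModel_Δ_eq, coe_a₁, coe_a₂, coe_a₃, coe_a₄, coe_two,
    coe_three] at hcd
  by_contra! hlt
  refine lt_irrefl ‖W.Δ‖ ?_
  conv_lhs => rw [hcd]
  exact norm_add_lt (norm_mul_lt (PadicInt.norm_le_one _) hlt.1)
    (norm_mul_lt (PadicInt.norm_le_one _) hlt.2)

variable (W) in
lemma index_filtrationSubgroup_zero_ne_zero (hΔ : W.Δ ≠ 0) :
    (filtrationSubgroup W 0).index ≠ 0 := by
  obtain ⟨N, hN⟩ := PadicInt.exists_pow_neg_lt p (norm_pos_iff.mpr hΔ)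
  -- Residues modulo `p ^ N`, with `p⁻ᴺ < |Δ|`, separate the cosets of `W^1`; all of `W^1` receives
  -- `none`. Finitely many codes give finite index without a compactness argument.
  let code : W.toAffine.Point → Option (ZMod (p ^ N) × ZMod (p ^ N))
    | .zero => none
    | .some x y _ => if h : ‖x‖ ≤ 1 ∧ ‖y‖ ≤ 1 then
        some (PadicInt.toZModPow N ⟨x, h.1⟩, PadicInt.toZModPow N ⟨y, h.2⟩) else none
  have code_coe (a b : ℤ_[p]) (h : W.toAffine.Nonsingular (a : ℚ_[p]) (b : ℚ_[p])) :
      code (.some _ _ h) = some (PadicInt.toZModPow N a, PadicInt.toZModPow N b) :=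
    dif_pos ⟨a.2, b.2⟩
  have code_of_mem (P : W.toAffine.Point) (hP : P ∈ filtration p W 1) : code P = none := by
    rcases P with _ | ⟨x, y, h⟩
    · rfl
    · exact dif_neg fun h' ↦ ((some_mem_filtration_one_iff h).mp hP).not_ge h'.1
  have hclose {a b : ℤ_[p]} (h : PadicInt.toZModPow N a = PadicInt.toZModPow N b) :
      ‖(a : ℚ_[p]) - b‖ < ‖W.Δ‖ := by
    rw [← sub_eq_zero, ← map_sub, ← RingHom.mem_ker, PadicInt.ker_toZModPow,
      ← PadicInt.norm_le_pow_iff_mem_span_pow] at h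
    exact h.trans_lt hN
  have key (P Q : W.toAffine.Point) (h : code P = code Q) : P - Q ∈ filtrationSubgroup W 1 := by
    rcases mem_filtration_one_or_exists P with hP | ⟨x₁, y₁, h₁, rfl⟩ <;>
      rcases mem_filtration_one_or_exists Q with hQ | ⟨x₂, y₂, h₂, rfl⟩
    · exact sub_mem (mem_filtrationSubgroup.mpr hP) (mem_filtrationSubgroup.mpr hQ)
    · rw [code_of_mem _ hP, code_coe _ _ h₂] at h
      cases h
    · rw [code_of_mem _ hQ, code_coe _ _ h₁] at h
      cases h
    · rw [code_coe _ _ h₁, code_coe _ _ h₂, Option.some.injEq, Prod.mk.injEq] at h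
      exact sub_mem_filtration_one h₁ h₂ (hclose h.1) (hclose h.2) (norm_Δ_le h₁.1)
  have : Finite (W.toAffine.Point ⧸ filtrationSubgroup W 0) := by
    refine Finite.of_injective (fun q ↦ code q.out) fun q r hqr ↦ ?_
    rw [← QuotientAddGroup.out_eq' q, ← QuotientAddGroup.out_eq' r, eq_comm, QuotientAddGroup.eq,
      ← sub_eq_neg_add]
    exact filtration_antitone zero_le_one (key _ _ hqr)
  exact AddSubgroup.index_ne_zero_of_finite

end

end PadicFiltration

/-! ### Integrality of the change of coordinates -/

namespace PadicFiltration

open WeierstrassCurve Polynomial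

variable {p : ℕ} [Fact p.Prime]

section VariableChange

variable {E E' : WeierstrassCurve ℚ_[p]} [WeierstrassCurve.IsIntegral ℤ_[p] E]
  [WeierstrassCurve.IsIntegral ℤ_[p] E'] {C : VariableChange ℚ_[p]}

/-- The relations for `b₆` and `b₈` have leading coefficients `4` and `3` in `r`, not units at `2`
and `3`. In `e₈ - r * e₆` the leading coefficient is `3 - 4 = -1`, so `r` is integral for every `p`.
-/
lemma norm_r_le_one (h : C • E = E') (hu : ‖(C.u : ℚ_[p])‖ ≤ 1) : ‖C.r‖ ≤ 1 := by
  obtain ⟨u, hu⟩ : ∃ a : ℤ_[p], (a : ℚ_[p]) = C.u := ⟨⟨_, hu⟩, rfl⟩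
  have h0 : (C.u : ℚ_[p]) ≠ 0 := C.u.ne_zero
  have e₆ : (C.u : ℚ_[p]) ^ 6 * E'.b₆ = E.b₆ + 2 * C.r * E.b₄ + C.r ^ 2 * E.b₂ + 4 * C.r ^ 3 := by
    rw [← h, variableChange_b₆, Units.val_inv_eq_inv_val]
    field_simp
  have e₈ : (C.u : ℚ_[p]) ^ 8 * E'.b₈ =
      E.b₈ + 3 * C.r * E.b₆ + 3 * C.r ^ 2 * E.b₄ + C.r ^ 3 * E.b₂ + 3 * C.r ^ 4 := by
    rw [← h, variableChange_b₈, Units.val_inv_eq_inv_val]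
    field_simp
  set V := integralModel ℤ_[p] E
  set V' := integralModel ℤ_[p] E'
  have hf : (X ^ 4 - Polynomial.C V.b₄ * X ^ 2 - Polynomial.C (2 * V.b₆ + u ^ 6 * V'.b₆) * X -
      Polynomial.C (V.b₈ - u ^ 8 * V'.b₈)).Monic := by
    monicity!
  refine norm_le_one_of_aeval_eq_zero hf ?_
  simp only [map_sub, map_add, map_mul, map_pow, aeval_X, aeval_C, V, V', integralModel_b₄_eq,
    integralModel_b₆_eq, integralModel_b₈_eq, PadicInt.algebraMap_apply u, hu, map_ofNat]
  linear_combination e₈ - C.r * e₆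

lemma norm_s_le_one (h : C • E = E') (hu : ‖(C.u : ℚ_[p])‖ ≤ 1) : ‖C.s‖ ≤ 1 := by
  obtain ⟨r, hr⟩ : ∃ a : ℤ_[p], (a : ℚ_[p]) = C.r := ⟨⟨_, norm_r_le_one h hu⟩, rfl⟩
  obtain ⟨u, hu⟩ : ∃ a : ℤ_[p], (a : ℚ_[p]) = C.u := ⟨⟨_, hu⟩, rfl⟩
  set V := integralModel ℤ_[p] E
  set V' := integralModel ℤ_[p] E'
  have hf : (X ^ 2 + Polynomial.C V.a₁ * X - Polynomial.C (V.a₂ + 3 * r - u ^ 2 * V'.a₂)).Monic := by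
    monicity!
  refine norm_le_one_of_aeval_eq_zero hf ?_
  simp only [map_sub, map_add, map_mul, map_pow, aeval_X, aeval_C, PadicInt.algebraMap_apply, V,
    V', coe_a₁, coe_a₂, hu, hr, coe_three]
  linear_combination -a₂_of_smul_eq h

lemma norm_t_le_one (h : C • E = E') (hu : ‖(C.u : ℚ_[p])‖ ≤ 1) : ‖C.t‖ ≤ 1 := by
  obtain ⟨r, hr⟩ : ∃ a : ℤ_[p], (a : ℚ_[p]) = C.r := ⟨⟨_, norm_r_le_one h hu⟩, rfl⟩
  obtain ⟨u, hu⟩ : ∃ a : ℤ_[p], (a : ℚ_[p]) = C.u := ⟨⟨_, hu⟩, rfl⟩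
  set V := integralModel ℤ_[p] E
  set V' := integralModel ℤ_[p] E'
  have hf : (X ^ 2 + Polynomial.C (V.a₃ + r * V.a₁) * X -
      Polynomial.C (V.a₆ + r * V.a₄ + r ^ 2 * V.a₂ + r ^ 3 - u ^ 6 * V'.a₆)).Monic := by
    monicity!
  refine norm_le_one_of_aeval_eq_zero hf ?_
  simp only [map_sub, map_add, map_mul, map_pow, aeval_X, aeval_C, PadicInt.algebraMap_apply, V,
    V', coe_a₁, coe_a₂, coe_a₃, coe_a₄, coe_a₆, hu, hr]
  linear_combination -a₆_of_smul_eq h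

/-- A change of coordinates from a non-minimal to a minimal equation multiplies by a non-unit. -/
lemma norm_u_lt_one (h : C • E = E') (hE : ¬ IsMinimal ℤ_[p] E) [IsMinimal ℤ_[p] E'] :
    ‖(C.u : ℚ_[p])‖ < 1 := by
  by_contra! hu
  refine hE ⟨⟨by simpa using ‹WeierstrassCurve.IsIntegral ℤ_[p] E›, fun D hD _ ↦ ?_⟩⟩
  -- Every integral equation `D • E` is also a change of `E'`, so minimality of `E'` bounds its
  -- discriminant. If `|u| ≥ 1`, then `|Δ(E')| ≤ |Δ(E)|`, and `E` would be minimal too.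
  have hDE : (D * C⁻¹) • E' = D • E := by
    rw [← h, smul_smul, inv_mul_cancel_right]
  have hmax : valuation_Δ_aux ℤ_[p] (D • E) ≤ valuation_Δ_aux ℤ_[p] E' := by
    have hmin := (IsMinimal.val_Δ_maximal (R := ℤ_[p]) (W := E')).2 (j := D * C⁻¹)
      (by simpa only [hDE] using hD)
    simp only [hDE, one_smul] at hmin
    exact (le_total _ _).elim hmin id
  simp only [one_smul]
  refine hmax.trans ?_
  rw [← Subtype.coe_le_coe, valuation_Δ_aux_eq_of_isIntegral, valuation_Δ_aux_eq_of_isIntegral]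
  have hinv : ‖((C.u : ℚ_[p])⁻¹) ^ 12‖ ≤ 1 := by
    rw [norm_pow, norm_inv]
    exact pow_le_one₀ (inv_nonneg.mpr (norm_nonneg _)) (inv_le_one_of_one_le₀ hu)
  obtain ⟨a, ha⟩ : ∃ a : ℤ_[p], (a : ℚ_[p]) = ((C.u : ℚ_[p])⁻¹) ^ 12 := ⟨⟨_, hinv⟩, rfl⟩
  rw [← h, variableChange_Δ, Units.val_inv_eq_inv_val, ← ha, map_mul, ← PadicInt.algebraMap_apply]
  exact mul_le_of_le_one_left' (IsDedekindDomain.HeightOneSpectrum.valuation_le_one _ a)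

end VariableChange

end PadicFiltration

/-- `E` is an elliptic curve over `ℚ` given by a Weierstrass equation which is integral but not
minimal at `p`, and `Emin` is a `p`-minimal equation obtained from it by the change of coordinates
`x = u²x' + r`, `y = u³y' + u²sx' + t`. The sets `E^n(ℚ_p)` and `Emin^n(ℚ_p)` are subgroups, here
`F n` and `G n`; the Tamagawa number is `c_p = [Emin(ℚ_p) : Emin^0(ℚ_p)] = (G 0).index`. -/
theorem mainTheorem3 (p : ℕ) [Fact p.Prime] [DecidableEq ℚ_[p]]
    (E : WeierstrassCurve ℚ) [E.IsElliptic]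
    [WeierstrassCurve.IsIntegral ℤ_[p] (E⁄ℚ_[p])]
    (hE : ¬ WeierstrassCurve.IsMinimal ℤ_[p] (E⁄ℚ_[p]))
    (Emin : WeierstrassCurve ℚ) [WeierstrassCurve.IsMinimal ℤ_[p] (Emin⁄ℚ_[p])]
    (C : WeierstrassCurve.VariableChange ℚ) (hC : C • E = Emin) :
    ∃ k : ℕ, 1 ≤ k ∧
      (k : ℚ) = ((padicValRat p E.Δ - padicValRat p Emin.Δ : ℤ) : ℚ) / 12 ∧
    ∃ (F : ℕ → AddSubgroup (E⁄ℚ_[p]).toAffine.Point)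
      (G : ℕ → AddSubgroup (Emin⁄ℚ_[p]).toAffine.Point)
      (φ : (E⁄ℚ_[p]).toAffine.Point ≃+ (Emin⁄ℚ_[p]).toAffine.Point),
      (∀ n, (F n : Set (E⁄ℚ_[p]).toAffine.Point) =
        PadicFiltration.filtration p (E⁄ℚ_[p]) n) ∧
      (∀ n, (G n : Set (Emin⁄ℚ_[p]).toAffine.Point) =
        PadicFiltration.filtration p (Emin⁄ℚ_[p]) n) ∧
      (∀ (x y : ℚ_[p]) (h : (Emin⁄ℚ_[p]).toAffine.Nonsingular x y),
        ∃ h' : (E⁄ℚ_[p]).toAffine.Nonsingular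
            (((C.u : ℚ) : ℚ_[p]) ^ 2 * x + (C.r : ℚ_[p]))
            (((C.u : ℚ) : ℚ_[p]) ^ 3 * y + ((C.u : ℚ) : ℚ_[p]) ^ 2 * (C.s : ℚ_[p]) * x
              + (C.t : ℚ_[p])),
          φ (.some _ _ h') = .some x y h) ∧
      (∀ n, (F n).map φ.toAddMonoidHom = G (n + k)) ∧
      (G 0).index ≠ 0 ∧
      (F 0).index = (G k).index ∧
      (G k).index =
        (G 0).index * PadicFiltration.numNonsingular p (Emin⁄ℚ_[p]) * p ^ (k - 1) := by
  have hsmul : C.map (algebraMap ℚ ℚ_[p]) • (E⁄ℚ_[p]) = Emin⁄ℚ_[p] := by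
    rw [← hC]
    exact WeierstrassCurve.map_variableChange ..
  have hmapu : ((C.map (algebraMap ℚ ℚ_[p])).u : ℚ_[p]) = ((C.u : ℚ) : ℚ_[p]) := rfl
  have hlt := PadicFiltration.norm_u_lt_one hsmul hE
  have hu0 : (C.u : ℚ) ≠ 0 := C.u.ne_zero
  have hp : (1 : ℝ) < p := mod_cast (Fact.out : p.Prime).one_lt
  have hnorm : ‖((C.map (algebraMap ℚ ℚ_[p])).u : ℚ_[p])‖ = (p : ℝ) ^ (-padicValRat p C.u) := by
    rw [hmapu, Padic.norm_eq_zpow_neg_valuation (by exact_mod_cast hu0), Padic.valuation_ratCast]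
  have hpos : 0 < padicValRat p C.u := by
    rw [hnorm, zpow_lt_one_iff_right₀ hp] at hlt
    omega
  obtain ⟨k, hk⟩ := Int.eq_ofNat_of_zero_le hpos.le
  have hk1 : 1 ≤ k := by omega
  have hu : ‖((C.map (algebraMap ℚ ℚ_[p])).u : ℚ_[p])‖ = ((p : ℝ) ^ k)⁻¹ := by
    rw [hnorm, hk, zpow_neg, zpow_natCast]
  have hΔ0 : E.Δ ≠ 0 := E.isUnit_Δ.ne_zero
  have hΔmin : Emin.Δ = ((C.u : ℚ)⁻¹) ^ 12 * E.Δ := by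
    rw [← hC, WeierstrassCurve.variableChange_Δ, Units.val_inv_eq_inv_val]
  have hΔ : (Emin⁄ℚ_[p]).Δ ≠ 0 := by
    rw [WeierstrassCurve.baseChange, WeierstrassCurve.map_Δ, hΔmin]
    exact (map_ne_zero _).mpr (mul_ne_zero (pow_ne_zero _ (inv_ne_zero hu0)) hΔ0)
  have hmap (n : ℕ) : (PadicFiltration.filtrationSubgroup (E⁄ℚ_[p]) n).map
      (WeierstrassCurve.pointEquivOfSMulEq hsmul).symm.toAddMonoidHom =
        PadicFiltration.filtrationSubgroup (Emin⁄ℚ_[p]) (n + k) := by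
    ext P
    rw [AddSubgroup.mem_map_equiv, PadicFiltration.mem_filtrationSubgroup,
      PadicFiltration.mem_filtrationSubgroup]
    exact PadicFiltration.pointEquivOfSMulEq_mem_filtration_iff hsmul hk1 hu
      (PadicFiltration.norm_r_le_one hsmul hlt.le) (PadicFiltration.norm_s_le_one hsmul hlt.le)
      (PadicFiltration.norm_t_le_one hsmul hlt.le) n P
  refine ⟨k, hk1, ?_, PadicFiltration.filtrationSubgroup (E⁄ℚ_[p]),
    PadicFiltration.filtrationSubgroup (Emin⁄ℚ_[p]),
    (WeierstrassCurve.pointEquivOfSMulEq hsmul).symm, fun _ ↦ rfl, fun _ ↦ rfl, fun x y h ↦ ?_,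
    hmap, PadicFiltration.index_filtrationSubgroup_zero_ne_zero _ hΔ, ?_, ?_⟩
  · rw [hΔmin, padicValRat.mul (pow_ne_zero _ (inv_ne_zero hu0)) hΔ0, padicValRat.pow,
      padicValRat.inv, hk]
    push_cast
    ring
  · exact ⟨(WeierstrassCurve.nonsingular_of_smul_eq hsmul x y).mpr h,
      (AddEquiv.symm_apply_eq _).mpr rfl⟩
  · have h0 := hmap 0
    rw [zero_add] at h0
    rw [← h0]
    exact (AddSubgroup.index_map_of_bijective
      (f := (WeierstrassCurve.pointEquivOfSMulEq hsmul).symm.toAddMonoidHom)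
      (WeierstrassCurve.pointEquivOfSMulEq hsmul).symm.bijective _).symm
  -- The first quotient contributes `N_p` and each of the remaining `k - 1` contributes `p`.
  · obtain ⟨j, rfl⟩ := Nat.exists_eq_add_of_le' hk1
    exact PadicFiltration.index_filtrationSubgroup_succ _ hΔ j
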